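/- Let $\mathbf{k}$ be an algebraically closed field of characteristic zero; all vector spaces and algebras are over $\mathbf{k}$, and algebras are associative with unity. **Quasi-finite algebras.** Let $A=\bigoplus_{d\in\mathbb Z}A(d)$ be a graded algebra ($A(d)A(e)\subset A(d+e)$, $1\in A(0)$), each $A(d)$ being endowed with a linear topology, i.e. one for which a decreasing sequence of subspaces (indexed by $\mathbb N$) is a fundamental system of open neighbourhoods of $0$. For $n\in\mathbb N$ let $I_n(A(d))$ be the closure in $A(d)$ of $\sum_{j\le -n-1}A(d-j)\cdot A(j)$, and put $Q_n(d)=A(d)/I_n(A(d))$. $A$ is a *compatible degreewise complete algebra* if the multiplications $A(d)\times A(e)\to A(d+e)$ are continuous, the $I_n(A(d))$ form a fundamental system of open neighbourhoods of $0$ in $A(d)$ for each $d$, and each $A(d)$ is complete and separated. Such an $A$ is *quasi-finite* if moreover $Q_n(d)$ is finite-dimensional for all $d\in\mathbb Z$ and $n\in\mathbb N$. **Vertex operator algebras.** A vertex operator algebra is a graded space $V=\bigoplus_{r\in\mathbb Z}V[r]$ with $V[r]=0$ for $r$ sufficiently negative, with bilinear products $(u,v)\mapsto u_{(n)}v$ ($n\in\mathbb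 Z$), a vacuum $\mathbf 1\in V[0]$ and a conformal vector $\omega\in V[2]$, such that $V[r]_{(n)}V[s]\subset V[r+s-n-1]$; the Borcherds identity $$\sum_{i\ge0}\binom pi(u_{(r+i)}v)_{(p+q-i)}w=\sum_{i\ge0}(-1)^i\binom ri\bigl(u_{(p+r-i)}(v_{(q+i)}w)-(-1)^r v_{(q+r-i)}(u_{(p+i)}w)\bigr)$$ holds for all $u,v,w\in V$ and $p,q,r\in\mathbb Z$; $u_{(-1)}\mathbf 1=u$ and $u_{(n)}\mathbf 1=0$ for $n\ge0$; $\omega_{(n)}\omega=0$ for $n\ge4$ and $n=2$, $\omega_{(1)}\omega=2\omega$, $\omega_{(3)}\omega\in\mathbf{k}\mathbf 1$; $V[r]=\{v:\omega_{(1)}v=rv\}$; and $Tu:=u_{(-2)}\mathbf 1=\omega_{(0)}u$ for all $u$. Let $C_2(V)$ be the span of all $u_{(n)}v$ with $n\le-2$. $V$ is *$C_2$-finite* (satisfies Zhu's finiteness condition) if $\dim V/C_2(V)<\infty$. **The current algebra.** Let $\mathfrak g=V[t,t^{-1}]/\partial V[t,t^{-1}]$, where $V[t,t^{-1}]=V\otimes\mathbf{k}[t,t^{-1}]$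 and $\partial(u\otimes t^n)=Tu\otimes t^n+n\,u\otimes t^{n-1}$, be the Lie algebra with bracket $[u\otimes t^m,v\otimes t^n]=\sum_{i\ge0}\binom mi(u_{(i)}v)\otimes t^{m+n-i}$. For $u\in V[r]$ put $J_n(u)=u\otimes t^{n+r-1}$, of degree $-n$. Let $\mathbb U$ be the quotient of the universal enveloping algebra of $\mathfrak g$ by the two-sided ideal generated by $J_0(\mathbf 1)-1$, graded by letting $\mathbb U(d)$ be the span of the products $J_{-d_1}(u_1)\cdots J_{-d_l}(u_l)$ with homogeneous $u_i$ and $d_1+\dots+d_l=d$. Let $\hat{\mathbb U}=\bigoplus_d\hat{\mathbb U}(d)$, where $\hat{\mathbb U}(d)$ is the completion of $\mathbb U(d)$ for the linear topology defined by the subspaces $\sum_{j\le-n-1}\mathbb U(d-j)\mathbb U(j)$, $n\in\mathbb N$. For $u\in V[r]$, $v\in V[s]$ and $a,b,n\in\mathbb Z$ put, in $\hat{\mathbb U}$, $$B_{a,b,n}(u,v)=\sum_{i\ge0}\binom{a+r-1}iJ_{a+b+n}(u_{(n+i)}v)-\sum_{i\ge0}(-1)^i\binom niJ_{a+n-i}(u)J_{b+i}(v)+(-1)^n\sum_{i\ge0}(-1)^i\binom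 niJ_{b+n-i}(v)J_{a+i}(u).$$ Let $\hat{\mathbb B}$ be the degreewise closure (the sum of the closures of the homogeneous subspaces) of the two-sided ideal of $\hat{\mathbb U}$ generated by all these elements. The *current algebra* of $V$ is $U(V)=\hat{\mathbb U}/\hat{\mathbb B}$ with the induced grading and the quotient topologies on its homogeneous subspaces. **Theorem.** If a vertex operator algebra $V$ is $C_2$-finite, then its current algebra $U(V)$ is quasi-finite: it is a compatible degreewise complete algebra and all the spaces $Q_n(d)=U(V)(d)/I_n(U(V)(d))$, $d\in\mathbb Z$, $n\in\mathbb N$, are finite-dimensional. -/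

import Mathlib

open scoped TensorProduct

noncomputable section

/-! ## Graded algebras with linear topologies on the homogeneous subspaces -/

section LowProducts

variable {k A : Type*} [Field k] [Ring A] [Algebra k A]

/-- The subspace `A(d) ∩ (A · F_{-n-1} A) = ∑_{j ≤ -n-1} A(d-j) · A(j)` of `A(d)`, for a graded
algebra `A` with homogeneous subspaces `gr d = A(d)`. -/
def lowProducts (gr : ℤ → Submodule k A) (d : ℤ) (n : ℕ) : Submodule k A :=
  ⨆ j : ℤ, ⨆ _ : j ≤ -(n : ℤ) - 1, gr (d - j) * gr j

end LowProducts

/-- A family of subspaces `gr d = A(d)` of an algebra `A` together with, on each `A(d)`, the linear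
topology given by a decreasing sequence of subspaces `nbhd d n`, `n = 0, 1, 2, …`: the sets
`a + nbhd d n` form a fundamental system of open neighbourhoods of `a ∈ A(d)`. -/
structure DegreewiseTopology (k A : Type*) [Field k] [Ring A] [Algebra k A] where
  gr : ℤ → Submodule k A
  nbhd : ℤ → ℕ → Submodule k A
  nbhd_le : ∀ d n, nbhd d n ≤ gr d
  nbhd_anti : ∀ d, Antitone (nbhd d)

namespace DegreewiseTopology

variable {k A : Type*} [Field k] [Ring A] [Algebra k A] (T : DegreewiseTopology k A)

/-- The closure in `A(d)` of the subspace `U ∩ A(d)`. -/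
def closure (d : ℤ) (U : Submodule k A) : Submodule k A :=
  ⨅ n, (U ⊓ T.gr d) ⊔ T.nbhd d n

/-- `I_n(A(d))`: the closure in `A(d)` of `A(d) ∩ (A · F_{-n-1} A)`. -/
def canonicalIdeal (d : ℤ) (n : ℕ) : Submodule k A :=
  T.closure d (lowProducts T.gr d n)

/-- `Q_n(d) = A(d) / I_n(A(d))`. -/
abbrev canonicalQuotient (d : ℤ) (n : ℕ) : Type _ :=
  T.gr d ⧸ (T.canonicalIdeal d n).submoduleOf (T.gr d)

/-- Compatible degreewise topological algebras. -/
structure IsCompatible : Prop where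
  /-- `1 ∈ A(0)` and `A(d) · A(e) ⊆ A(d + e)` -/
  gradedMonoid : SetLike.GradedMonoid T.gr
  /-- `A = ⨁_d A(d)` -/
  isInternal : DirectSum.IsInternal T.gr
  /-- each multiplication map `A(d) × A(e) → A(d + e)` is continuous -/
  continuous_mul : ∀ d e, ∀ a ∈ T.gr d, ∀ b ∈ T.gr e, ∀ n, ∃ m,
    ∀ x ∈ T.nbhd d m, ∀ y ∈ T.nbhd e m, (a + x) * (b + y) - a * b ∈ T.nbhd (d + e) n
  /-- the subspaces `I_n(A(d))` are open -/
  isOpen : ∀ d n, ∃ m, T.nbhd d m ≤ T.canonicalIdeal d n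
  /-- every neighbourhood of zero in `A(d)` contains some `I_n(A(d))` -/
  basis : ∀ d m, ∃ n, T.canonicalIdeal d n ≤ T.nbhd d m

/-- Each `A(d)` is complete: the canonical map `A(d) → lim_n A(d) / nbhd d n` is injective and
surjective. -/
structure IsComplete : Prop where
  separated : ∀ d, ⨅ n, T.nbhd d n = ⊥
  exists_lim : ∀ d (x : ℕ → A), (∀ n, x n ∈ T.gr d) → (∀ n, x (n + 1) - x n ∈ T.nbhd d n) →
    ∃ a ∈ T.gr d, ∀ n, a - x n ∈ T.nbhd d n

/-- Quasi-finite algebras: compatible degreewise complete algebras such that all the spaces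
`Q_n(d)` are finite-dimensional. -/
structure IsQuasiFinite : Prop where
  compatible : T.IsCompatible
  complete : T.IsComplete
  finite : ∀ (d : ℤ) (n : ℕ), FiniteDimensional k (T.canonicalQuotient d n)

end DegreewiseTopology

/-! ## The standard degreewise completion of a graded algebra

The completion `Â(d)` of `A(d)` for the linear topology defined by the `lowProducts` is built from
Cauchy sequences modulo null sequences, inside the algebra of all sequences in `A`. -/

section Completion

variable {k A : Type*} [Field k] [Ring A] [Algebra k A] (𝒜 : ℤ → Submodule k A)

/-- Cauchy sequences in `A(d)`. -/
def cauchySeq (d : ℤ) : Submodule k (ℕ → A) where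
  carrier := {x | (∀ i, x i ∈ 𝒜 d) ∧
    ∀ n, ∃ N, ∀ i ≥ N, ∀ j ≥ N, x i - x j ∈ lowProducts 𝒜 d n}
  zero_mem' := ⟨fun _ => zero_mem _, fun _ => ⟨0, fun _ _ _ _ => by simp⟩⟩
  add_mem' := by
    rintro x y ⟨hx, hx'⟩ ⟨hy, hy'⟩
    refine ⟨fun i => add_mem (hx i) (hy i), fun n => ?_⟩
    obtain ⟨N, hN⟩ := hx' n
    obtain ⟨M, hM⟩ := hy' n
    refine ⟨max N M, fun i hi j hj => ?_⟩
    have := add_mem (hN i (le_trans (le_max_left _ _) hi) j (le_trans (le_max_left _ _) hj))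
      (hM i (le_trans (le_max_right _ _) hi) j (le_trans (le_max_right _ _) hj))
    simpa [add_sub_add_comm] using this
  smul_mem' := by
    rintro c x ⟨hx, hx'⟩
    refine ⟨fun i => Submodule.smul_mem _ c (hx i), fun n => ?_⟩
    obtain ⟨N, hN⟩ := hx' n
    refine ⟨N, fun i hi j hj => ?_⟩
    have := Submodule.smul_mem _ c (hN i hi j hj)
    simpa [smul_sub] using this

/-- Sequences in `A(d)` whose terms eventually lie in the `n`-th neighbourhood of zero. -/
def smallSeq (d : ℤ) (n : ℕ) : Submodule k (ℕ → A) where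
  carrier := {x | (∀ i, x i ∈ 𝒜 d) ∧ ∃ N, ∀ i ≥ N, x i ∈ lowProducts 𝒜 d n}
  zero_mem' := ⟨fun _ => zero_mem _, 0, fun _ _ => zero_mem _⟩
  add_mem' := by
    rintro x y ⟨hx, N, hN⟩ ⟨hy, M, hM⟩
    exact ⟨fun i => add_mem (hx i) (hy i), max N M, fun i hi =>
      add_mem (hN i (le_trans (le_max_left _ _) hi)) (hM i (le_trans (le_max_right _ _) hi))⟩
  smul_mem' := by
    rintro c x ⟨hx, N, hN⟩
    exact ⟨fun i => Submodule.smul_mem _ c (hx i), N, fun i hi => Submodule.smul_mem _ c (hN i hi)⟩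

/-- Sequences in `A(d)` converging to zero. -/
def nullSeq (d : ℤ) : Submodule k (ℕ → A) := ⨅ n, smallSeq 𝒜 d n

theorem lowProducts_anti (d : ℤ) : Antitone (lowProducts 𝒜 d) := by
  intro m n h
  refine iSup_mono fun j => iSup_mono' fun hj => ⟨by omega, le_rfl⟩

theorem nullSeq_le_cauchySeq (d : ℤ) : nullSeq 𝒜 d ≤ cauchySeq 𝒜 d := by
  intro x hx
  rw [nullSeq, Submodule.mem_iInf] at hx
  refine ⟨(hx 0).1, fun n => ?_⟩
  obtain ⟨N, hN⟩ := (hx n).2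
  exact ⟨N, fun i hi j hj => sub_mem (hN i hi) (hN j hj)⟩

variable [SetLike.GradedMonoid 𝒜]

theorem gr_mul_gr_le (d e : ℤ) : 𝒜 d * 𝒜 e ≤ 𝒜 (d + e) :=
  Submodule.mul_le.2 fun _ ha _ hb => SetLike.mul_mem_graded ha hb

theorem lowProducts_le (d : ℤ) (n : ℕ) : lowProducts 𝒜 d n ≤ 𝒜 d := by
  refine iSup_le fun j => iSup_le fun _ => (gr_mul_gr_le 𝒜 _ _).trans ?_
  rw [sub_add_cancel]

theorem gr_mul_lowProducts_le (d e : ℤ) (n : ℕ) :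
    𝒜 d * lowProducts 𝒜 e n ≤ lowProducts 𝒜 (d + e) n := by
  simp only [lowProducts, Submodule.mul_iSup]
  refine iSup_mono fun j => iSup_mono fun hj => ?_
  rw [← mul_assoc]
  refine mul_le_mul_left ((gr_mul_gr_le 𝒜 _ _).trans ?_) _
  rw [add_sub_assoc]

theorem lowProducts_mul_gr_le (d e : ℤ) (m n : ℕ) (h : (n : ℤ) + e ≤ m) :
    lowProducts 𝒜 d m * 𝒜 e ≤ lowProducts 𝒜 (d + e) n := by
  simp only [lowProducts, Submodule.iSup_mul]
  refine iSup_le fun j => iSup_le fun hj => ?_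
  rw [mul_assoc]
  have h1 : 𝒜 (d - j) * (𝒜 j * 𝒜 e) ≤ 𝒜 (d + e - (j + e)) * 𝒜 (j + e) := by
    rw [add_sub_add_right_eq_sub]
    exact mul_le_mul_right (gr_mul_gr_le 𝒜 _ _) _
  exact h1.trans (le_iSup_of_le (j + e) (le_iSup_of_le (by omega) le_rfl))

theorem cauchySeq_mul_mem {d e : ℤ} {x y : ℕ → A} (hx : x ∈ cauchySeq 𝒜 d)
    (hy : y ∈ cauchySeq 𝒜 e) : x * y ∈ cauchySeq 𝒜 (d + e) := by
  refine ⟨fun i => SetLike.mul_mem_graded (hx.1 i) (hy.1 i), fun n => ?_⟩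
  obtain ⟨N, hN⟩ := hx.2 ((n : ℤ) + e).toNat
  obtain ⟨M, hM⟩ := hy.2 n
  refine ⟨max N M, fun i hi j hj => ?_⟩
  have h1 : x i * (y i - y j) ∈ lowProducts 𝒜 (d + e) n :=
    gr_mul_lowProducts_le 𝒜 d e n (Submodule.mul_mem_mul (hx.1 i)
      (hM i (le_trans (le_max_right _ _) hi) j (le_trans (le_max_right _ _) hj)))
  have h2 : (x i - x j) * y j ∈ lowProducts 𝒜 (d + e) n :=
    lowProducts_mul_gr_le 𝒜 d e _ n (Int.self_le_toNat _) (Submodule.mul_mem_mul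
      (hN i (le_trans (le_max_left _ _) hi) j (le_trans (le_max_left _ _) hj)) (hy.1 j))
  have h3 : (x * y) i - (x * y) j = x i * (y i - y j) + (x i - x j) * y j := by
    simp only [Pi.mul_apply]; noncomm_ring
  rw [h3]
  exact add_mem h1 h2

theorem cauchySeq_mul_smallSeq_mem {d e : ℤ} {n : ℕ} {x y : ℕ → A} (hx : x ∈ cauchySeq 𝒜 d)
    (hy : y ∈ smallSeq 𝒜 e n) : x * y ∈ smallSeq 𝒜 (d + e) n := by
  refine ⟨fun i => SetLike.mul_mem_graded (hx.1 i) (hy.1 i), ?_⟩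
  obtain ⟨N, hN⟩ := hy.2
  exact ⟨N, fun i hi => gr_mul_lowProducts_le 𝒜 d e n (Submodule.mul_mem_mul (hx.1 i) (hN i hi))⟩

theorem smallSeq_mul_cauchySeq_mem {d e : ℤ} {m n : ℕ} (h : (n : ℤ) + e ≤ m) {x y : ℕ → A}
    (hx : x ∈ smallSeq 𝒜 d m) (hy : y ∈ cauchySeq 𝒜 e) : x * y ∈ smallSeq 𝒜 (d + e) n := by
  refine ⟨fun i => SetLike.mul_mem_graded (hx.1 i) (hy.1 i), ?_⟩
  obtain ⟨N, hN⟩ := hx.2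
  exact ⟨N, fun i hi =>
    lowProducts_mul_gr_le 𝒜 d e m n h (Submodule.mul_mem_mul (hN i hi) (hy.1 i))⟩

/-- The algebra `⨁_d {Cauchy sequences in A(d)}`, with termwise operations. -/
def cauchyAlg : Subalgebra k (ℕ → A) :=
  (⨆ d, cauchySeq 𝒜 d).toSubalgebra
    (Submodule.mem_iSup_of_mem 0 ⟨fun _ => SetLike.GradedOne.one_mem,
      fun _ => ⟨0, fun _ _ _ _ => by simp⟩⟩)
    (by
      intro x y hx hy
      have h : (⨆ d, cauchySeq 𝒜 d) * (⨆ d, cauchySeq 𝒜 d) ≤ ⨆ d, cauchySeq 𝒜 d := by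
        simp only [Submodule.iSup_mul, Submodule.mul_iSup]
        exact iSup_le fun d => iSup_le fun e => (Submodule.mul_le.2 fun a ha b hb =>
          cauchySeq_mul_mem 𝒜 ha hb).trans (le_iSup (cauchySeq 𝒜) (e + d))
      exact h (Submodule.mul_mem_mul hx hy))

/-- The ideal `⨁_d {null sequences in A(d)}` of `cauchyAlg`. -/
def nullIdeal : Ideal (cauchyAlg 𝒜) where
  carrier := {x | (x : ℕ → A) ∈ ⨆ d, nullSeq 𝒜 d}
  zero_mem' := zero_mem (⨆ d, nullSeq 𝒜 d)
  add_mem' := fun hx hy => Submodule.add_mem (⨆ d, nullSeq 𝒜 d) hx hy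
  smul_mem' := by
    rintro ⟨x, hx⟩ ⟨y, hy'⟩ hy
    have h : (⨆ d, cauchySeq 𝒜 d) * (⨆ d, nullSeq 𝒜 d) ≤ ⨆ d, nullSeq 𝒜 d := by
      simp only [Submodule.iSup_mul, Submodule.mul_iSup]
      refine iSup_le fun d => iSup_le fun e => (Submodule.mul_le.2 fun a ha b hb => ?_).trans
        (le_iSup (nullSeq 𝒜) (e + d))
      rw [nullSeq, Submodule.mem_iInf] at hb ⊢
      exact fun n => cauchySeq_mul_smallSeq_mem 𝒜 ha (hb n)
    exact h (Submodule.mul_mem_mul hx hy)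

instance : (nullIdeal 𝒜).IsTwoSided where
  mul_mem_of_left := by
    rintro ⟨x, hx'⟩ ⟨y, hy⟩ hx
    change x ∈ ⨆ d, nullSeq 𝒜 d at hx
    have h : (⨆ d, nullSeq 𝒜 d) * (⨆ d, cauchySeq 𝒜 d) ≤ ⨆ d, nullSeq 𝒜 d := by
      simp only [Submodule.iSup_mul, Submodule.mul_iSup]
      refine iSup_le fun d => iSup_le fun e => (Submodule.mul_le.2 fun a ha b hb => ?_).trans
        (le_iSup (nullSeq 𝒜) (e + d))
      rw [nullSeq, Submodule.mem_iInf] at ha ⊢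
      exact fun n => smallSeq_mul_cauchySeq_mem 𝒜 (Int.self_le_toNat _) (ha _) hb
    exact h (Submodule.mul_mem_mul hx hy)

/-- The standard degreewise completion `Â = ⨁_d Â(d)`. -/
def DegreewiseCompletion : Type _ := cauchyAlg 𝒜 ⧸ nullIdeal 𝒜

namespace DegreewiseCompletion

instance : Ring (DegreewiseCompletion 𝒜) := inferInstanceAs (Ring (cauchyAlg 𝒜 ⧸ nullIdeal 𝒜))

instance : Algebra k (DegreewiseCompletion 𝒜) :=
  inferInstanceAs (Algebra k (cauchyAlg 𝒜 ⧸ nullIdeal 𝒜))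

/-- The homomorphism sending a Cauchy sequence to its class. -/
def mk : cauchyAlg 𝒜 →ₐ[k] DegreewiseCompletion 𝒜 := Ideal.Quotient.mkₐ k (nullIdeal 𝒜)

/-- The limit in `Â(d)` of a Cauchy sequence in `A(d)`. -/
def lim {d : ℤ} (x : ℕ → A) (hx : x ∈ cauchySeq 𝒜 d) : DegreewiseCompletion 𝒜 :=
  mk 𝒜 ⟨x, Submodule.mem_iSup_of_mem d hx⟩

/-- The homogeneous subspaces `Â(d)`, each with its topology of a completion: the `n`-th
neighbourhood of zero is the kernel of `Â(d) → A(d) / lowProducts d n`. -/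
def topology : DegreewiseTopology k (DegreewiseCompletion 𝒜) where
  gr d := ((cauchySeq 𝒜 d).comap (cauchyAlg 𝒜).val.toLinearMap).map (mk 𝒜).toLinearMap
  nbhd d n := ((cauchySeq 𝒜 d ⊓ smallSeq 𝒜 d n).comap (cauchyAlg 𝒜).val.toLinearMap).map
    (mk 𝒜).toLinearMap
  nbhd_le d n := Submodule.map_mono (Submodule.comap_mono inf_le_left)
  nbhd_anti d m n h := by
    refine Submodule.map_mono (Submodule.comap_mono (inf_le_inf_left _ ?_))
    rintro x ⟨hx, N, hN⟩
    exact ⟨hx, N, fun i hi => lowProducts_anti 𝒜 d h (hN i hi)⟩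

theorem iSup_gr : ⨆ d, (topology 𝒜).gr d = ⊤ := by
  rw [eq_top_iff]
  rintro x -
  obtain ⟨⟨y, hy⟩, rfl⟩ := Ideal.Quotient.mkₐ_surjective k (nullIdeal 𝒜) x
  have key : ∀ z (hz : z ∈ ⨆ d, cauchySeq 𝒜 d),
      mk 𝒜 ⟨z, hz⟩ ∈ ⨆ d, (topology 𝒜).gr d := by
    intro z hz
    induction hz using Submodule.iSup_induction' with
    | mem i x hx =>
      exact Submodule.mem_iSup_of_mem i ⟨⟨x, Submodule.mem_iSup_of_mem i hx⟩, hx, rfl⟩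
    | zero => exact zero_mem _
    | add x y hx hy h1 h2 => exact add_mem h1 h2
  exact key y hy

theorem gr_mul_gr_mem {d e : ℤ} {a b : DegreewiseCompletion 𝒜} (ha : a ∈ (topology 𝒜).gr d)
    (hb : b ∈ (topology 𝒜).gr e) : a * b ∈ (topology 𝒜).gr (d + e) := by
  obtain ⟨x, hx, rfl⟩ := ha
  obtain ⟨y, hy, rfl⟩ := hb
  exact ⟨x * y, cauchySeq_mul_mem 𝒜 hx hy, map_mul (mk 𝒜) x y⟩

theorem gr_mul_nbhd_mem {d e : ℤ} {n : ℕ} {a b : DegreewiseCompletion 𝒜}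
    (ha : a ∈ (topology 𝒜).gr d) (hb : b ∈ (topology 𝒜).nbhd e n) :
    a * b ∈ (topology 𝒜).nbhd (d + e) n := by
  obtain ⟨x, hx, rfl⟩ := ha
  obtain ⟨y, hy, rfl⟩ := hb
  exact ⟨x * y, ⟨cauchySeq_mul_mem 𝒜 hx hy.1, cauchySeq_mul_smallSeq_mem 𝒜 hx hy.2⟩,
    map_mul (mk 𝒜) x y⟩

theorem nbhd_mul_gr_mem {d e : ℤ} {m n : ℕ} (h : (n : ℤ) + e ≤ m) {a b : DegreewiseCompletion 𝒜}
    (ha : a ∈ (topology 𝒜).nbhd d m) (hb : b ∈ (topology 𝒜).gr e) :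
    a * b ∈ (topology 𝒜).nbhd (d + e) n := by
  obtain ⟨x, hx, rfl⟩ := ha
  obtain ⟨y, hy, rfl⟩ := hb
  exact ⟨x * y, ⟨cauchySeq_mul_mem 𝒜 hx.1 hy, smallSeq_mul_cauchySeq_mem 𝒜 h hx.2 hy⟩,
    map_mul (mk 𝒜) x y⟩

variable (S : Set (DegreewiseCompletion 𝒜))

/-- The two-sided ideal of `Â` generated by `S`, as a subspace. -/
def idealSpan : Submodule k (DegreewiseCompletion 𝒜) :=
  (TwoSidedIdeal.asIdeal (TwoSidedIdeal.span S)).restrictScalars k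

theorem mem_idealSpan {x : DegreewiseCompletion 𝒜} :
    x ∈ idealSpan 𝒜 S ↔ x ∈ TwoSidedIdeal.span S := TwoSidedIdeal.mem_asIdeal

/-- The degreewise closure of the two-sided ideal of `Â` generated by `S`, as a subspace: the sum
of the closures of its homogeneous subspaces. -/
def closedSpan : Submodule k (DegreewiseCompletion 𝒜) :=
  ⨆ d, (topology 𝒜).closure d (idealSpan 𝒜 S)

theorem mul_closure_mem {d e : ℤ} {a b : DegreewiseCompletion 𝒜} (ha : a ∈ (topology 𝒜).gr d)
    (hb : b ∈ (topology 𝒜).closure e (idealSpan 𝒜 S)) :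
    a * b ∈ (topology 𝒜).closure (d + e) (idealSpan 𝒜 S) := by
  rw [DegreewiseTopology.closure, Submodule.mem_iInf] at hb ⊢
  intro n
  obtain ⟨y, hy, z, hz, rfl⟩ := Submodule.mem_sup.1 (hb n)
  rw [mul_add]
  refine Submodule.add_mem_sup ⟨?_, gr_mul_gr_mem 𝒜 ha hy.2⟩ (gr_mul_nbhd_mem 𝒜 ha hz)
  exact (mem_idealSpan 𝒜 S).2 (TwoSidedIdeal.mul_mem_left _ _ _ ((mem_idealSpan 𝒜 S).1 hy.1))

theorem closure_mul_mem {d e : ℤ} {a b : DegreewiseCompletion 𝒜}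
    (ha : a ∈ (topology 𝒜).closure d (idealSpan 𝒜 S)) (hb : b ∈ (topology 𝒜).gr e) :
    a * b ∈ (topology 𝒜).closure (d + e) (idealSpan 𝒜 S) := by
  rw [DegreewiseTopology.closure, Submodule.mem_iInf] at ha ⊢
  intro n
  obtain ⟨y, hy, z, hz, rfl⟩ := Submodule.mem_sup.1 (ha ((n : ℤ) + e).toNat)
  rw [add_mul]
  refine Submodule.add_mem_sup ⟨?_, gr_mul_gr_mem 𝒜 hy.2 hb⟩
    (nbhd_mul_gr_mem 𝒜 (Int.self_le_toNat _) hz hb)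
  exact (mem_idealSpan 𝒜 S).2 (TwoSidedIdeal.mul_mem_right _ _ _ ((mem_idealSpan 𝒜 S).1 hy.1))

/-- The degreewise closure of the two-sided ideal generated by `S` is an ideal. -/
def closedIdeal : Ideal (DegreewiseCompletion 𝒜) where
  carrier := closedSpan 𝒜 S
  zero_mem' := zero_mem _
  add_mem' := fun hx hy => add_mem hx hy
  smul_mem' := by
    intro x y hy
    have h : (⨆ d, (topology 𝒜).gr d) * closedSpan 𝒜 S ≤ closedSpan 𝒜 S := by
      simp only [closedSpan, Submodule.iSup_mul, Submodule.mul_iSup]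
      exact iSup_le fun d => iSup_le fun e => (Submodule.mul_le.2 fun a ha b hb =>
        mul_closure_mem 𝒜 S ha hb).trans
        (le_iSup (fun d => (topology 𝒜).closure d (idealSpan 𝒜 S)) (e + d))
    exact h (Submodule.mul_mem_mul (by rw [iSup_gr]; trivial) hy)

instance : (closedIdeal 𝒜 S).IsTwoSided where
  mul_mem_of_left := by
    intro x y hx
    have h : closedSpan 𝒜 S * (⨆ d, (topology 𝒜).gr d) ≤ closedSpan 𝒜 S := by
      simp only [closedSpan, Submodule.iSup_mul, Submodule.mul_iSup]
      exact iSup_le fun d => iSup_le fun e => (Submodule.mul_le.2 fun a ha b hb =>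
        closure_mul_mem 𝒜 S ha hb).trans
        (le_iSup (fun d => (topology 𝒜).closure d (idealSpan 𝒜 S)) (e + d))
    exact h (Submodule.mul_mem_mul hx (by rw [iSup_gr]; trivial))

/-- The quotient of `Â` by the degreewise closure of the two-sided ideal generated by `S`. -/
def ClosedQuotient : Type _ := DegreewiseCompletion 𝒜 ⧸ closedIdeal 𝒜 S

instance : Ring (ClosedQuotient 𝒜 S) :=
  inferInstanceAs (Ring (DegreewiseCompletion 𝒜 ⧸ closedIdeal 𝒜 S))

instance : Algebra k (ClosedQuotient 𝒜 S) :=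
  inferInstanceAs (Algebra k (DegreewiseCompletion 𝒜 ⧸ closedIdeal 𝒜 S))

/-- The canonical homomorphism from `Â` to the quotient. -/
def toClosedQuotient : DegreewiseCompletion 𝒜 →ₐ[k] ClosedQuotient 𝒜 S :=
  Ideal.Quotient.mkₐ k (closedIdeal 𝒜 S)

/-- The homogeneous subspaces of the quotient algebra, with the quotient topologies. -/
def quotientTopology : DegreewiseTopology k (ClosedQuotient 𝒜 S) where
  gr d := ((topology 𝒜).gr d).map (toClosedQuotient 𝒜 S).toLinearMap
  nbhd d n := ((topology 𝒜).nbhd d n).map (toClosedQuotient 𝒜 S).toLinearMap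
  nbhd_le d n := Submodule.map_mono ((topology 𝒜).nbhd_le d n)
  nbhd_anti d _ _ h := Submodule.map_mono ((topology 𝒜).nbhd_anti d h)

end DegreewiseCompletion

end Completion

/-! ## Vertex operator algebras -/

/-- A vertex operator algebra structure on a vector space `V`. Here `wt r` is the subspace `V[r]`
of vectors of weight `r`, and `op n u v` is the product `u_(n) v`. All sums `∑ᶠ` below have only
finitely many nonzero terms, by `wt_bounded` and `op_mem`. -/
structure VertexOperatorAlgebra (k V : Type*) [Field k] [AddCommGroup V] [Module k V] where
  wt : ℤ → Submodule k V
  isInternal : DirectSum.IsInternal wt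
  wt_bounded : ∃ m : ℕ, ∀ r : ℤ, r < -(m : ℤ) → wt r = ⊥
  op : ℤ → V →ₗ[k] V →ₗ[k] V
  op_mem : ∀ (n r s : ℤ) (u v : V), u ∈ wt r → v ∈ wt s → op n u v ∈ wt (r + s - n - 1)
  borcherds : ∀ (p q r : ℤ) (u v w : V),
    ∑ᶠ i : ℕ, Ring.choose p i • op (p + q - i) (op (r + i) u v) w =
      ∑ᶠ i : ℕ, ((-1) ^ i * Ring.choose r i) •
        (op (p + r - i) u (op (q + i) v w)
          - (r.negOnePow : ℤ) • op (q + r - i) v (op (p + i) u w))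
  vac : V
  vac_mem : vac ∈ wt 0
  op_neg_one_vac : ∀ u, op (-1) u vac = u
  op_vac : ∀ (n : ℤ) (u : V), 0 ≤ n → op n u vac = 0
  omega : V
  omega_mem : omega ∈ wt 2
  op_omega_eq_zero : ∀ n : ℤ, 4 ≤ n ∨ n = 2 → op n omega omega = 0
  op_one_omega : op 1 omega omega = (2 : k) • omega
  op_three_omega : ∃ c : k, op 3 omega omega = c • vac
  /-- `V[r]` is the eigenspace of `L_0 = ω_(1)` with eigenvalue `r` -/
  mem_wt_iff : ∀ (r : ℤ) (v : V), v ∈ wt r ↔ op 1 omega v = (r : k) • v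
  /-- `T u = u_(-2) 1` agrees with `L_{-1} u = ω_(0) u` -/
  translation_eq : ∀ u, op (-2) u vac = op 0 omega u

namespace VertexOperatorAlgebra

variable {k V : Type*} [Field k] [AddCommGroup V] [Module k V] (𝒱 : VertexOperatorAlgebra k V)

/-- The translation operator `T u = u_(-2) 1`. -/
def translation : V →ₗ[k] V := (𝒱.op (-2)).flip 𝒱.vac

/-- `C_2(V)`: the span of all `u_(n) v` with `n ≤ -2`. -/
def C2 : Submodule k V := Submodule.span k {x | ∃ (n : ℤ) (u v : V), n ≤ -2 ∧ 𝒱.op n u v = x}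

/-- Zhu's finiteness condition: `V / C_2(V)` is finite-dimensional. -/
def IsC2Finite : Prop := FiniteDimensional k (V ⧸ 𝒱.C2)

/-! ### The current Lie algebra and its enveloping algebra -/

/-- The subspace `∂ V[t, t⁻¹]` of `V[t, t⁻¹] = V ⊗ k[t, t⁻¹]`, where
`∂ (u ⊗ t^n) = T u ⊗ t^n + n u ⊗ t^(n-1)`. -/
def derivationRange : Submodule k (V ⊗[k] LaurentPolynomial k) :=
  Submodule.span k {x | ∃ (u : V) (n : ℤ),
    𝒱.translation u ⊗ₜ[k] LaurentPolynomial.T n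
      + n • (u ⊗ₜ[k] (LaurentPolynomial.T (n - 1) : LaurentPolynomial k)) = x}

/-- The underlying space of the current Lie algebra `𝔤 = V[t, t⁻¹] / ∂ V[t, t⁻¹]`. -/
abbrev CurrentLie : Type _ := (V ⊗[k] LaurentPolynomial k) ⧸ 𝒱.derivationRange

/-- The class of `u ⊗ t^n` in `𝔤`. -/
def lieMode (u : V) (n : ℤ) : 𝒱.CurrentLie :=
  𝒱.derivationRange.mkQ (u ⊗ₜ[k] LaurentPolynomial.T n)

/-- The class in `𝔤` of the bracket
`[u ⊗ t^m, v ⊗ t^n] = ∑_{i ≥ 0} binom(m, i) (u_(i) v) ⊗ t^(m+n-i)`, a finite sum. -/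
def lieBracket (u : V) (m : ℤ) (v : V) (n : ℤ) : 𝒱.CurrentLie :=
  ∑ᶠ i : ℕ, Ring.choose m i • 𝒱.lieMode (𝒱.op i u v) (m + n - i)

/-- The defining relations of the quotient of the universal enveloping algebra of `𝔤` by the
two-sided ideal generated by `J_0(1) - 1 = 1 ⊗ t⁻¹ - 1`, as a quotient of the tensor algebra of
`𝔤`. -/
inductive EnvelopingRel : TensorAlgebra k 𝒱.CurrentLie → TensorAlgebra k 𝒱.CurrentLie → Prop
  | bracket (u : V) (m : ℤ) (v : V) (n : ℤ) : EnvelopingRel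
      (TensorAlgebra.ι k (𝒱.lieMode u m) * TensorAlgebra.ι k (𝒱.lieMode v n)
        - TensorAlgebra.ι k (𝒱.lieMode v n) * TensorAlgebra.ι k (𝒱.lieMode u m))
      (TensorAlgebra.ι k (𝒱.lieBracket u m v n))
  | vac : EnvelopingRel (TensorAlgebra.ι k (𝒱.lieMode 𝒱.vac (-1))) 1

/-- The algebra `𝕌`: the quotient of the universal enveloping algebra of the current Lie algebra
by the two-sided ideal generated by `J_0(1) - 1`. -/
def Enveloping : Type _ := RingQuot 𝒱.EnvelopingRel

instance : Ring 𝒱.Enveloping := inferInstanceAs (Ring (RingQuot 𝒱.EnvelopingRel))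

instance : Algebra k 𝒱.Enveloping := inferInstanceAs (Algebra k (RingQuot 𝒱.EnvelopingRel))

/-- The canonical homomorphism from the tensor algebra of `𝔤` to `𝕌`. -/
def toEnveloping : TensorAlgebra k 𝒱.CurrentLie →ₐ[k] 𝒱.Enveloping :=
  RingQuot.mkAlgHom k 𝒱.EnvelopingRel

/-- For `u` of weight `r`, the element `J_n(u)` of `𝕌`: the image of `u ⊗ t^(n+r-1)`. -/
def J (r n : ℤ) (u : V) : 𝒱.Enveloping :=
  𝒱.toEnveloping (TensorAlgebra.ι k (𝒱.lieMode u (n + r - 1)))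

/-- The products `J_{-d_1}(u_1) ⋯ J_{-d_l}(u_l)` of degree `d_1 + ⋯ + d_l = d`, with homogeneous
`u_1, …, u_l`. -/
inductive IsMonomial : ℤ → 𝒱.Enveloping → Prop
  | one : IsMonomial 0 1
  | mul (r n d : ℤ) (u : V) (x : 𝒱.Enveloping) (hu : u ∈ 𝒱.wt r) (hx : IsMonomial d x) :
      IsMonomial (-n + d) (𝒱.J r n u * x)

/-- The homogeneous subspace `𝕌(d)`. -/
def envelopingGr (d : ℤ) : Submodule k 𝒱.Enveloping := Submodule.span k {x | 𝒱.IsMonomial d x}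

theorem IsMonomial.mul_mem {d e : ℤ} {x y : 𝒱.Enveloping} (hx : 𝒱.IsMonomial d x)
    (hy : 𝒱.IsMonomial e y) : 𝒱.IsMonomial (d + e) (x * y) := by
  induction hx with
  | one => simpa using hy
  | mul r n d u x hu _ ih =>
    rw [mul_assoc, add_assoc]
    exact .mul r n _ u _ hu ih

instance : SetLike.GradedMonoid 𝒱.envelopingGr where
  one_mem := Submodule.subset_span .one
  mul_mem := by
    intro d e x y hx hy
    have h : 𝒱.envelopingGr d * 𝒱.envelopingGr e ≤ 𝒱.envelopingGr (d + e) := by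
      rw [envelopingGr, envelopingGr, Submodule.span_mul_span]
      refine Submodule.span_mono ?_
      rintro _ ⟨a, ha, b, hb, rfl⟩
      exact IsMonomial.mul_mem 𝒱 ha hb
    exact h (Submodule.mul_mem_mul hx hy)

theorem J_mem {r : ℤ} (n : ℤ) {u : V} (hu : u ∈ 𝒱.wt r) : 𝒱.J r n u ∈ 𝒱.envelopingGr (-n) := by
  have := IsMonomial.mul r n 0 u 1 hu (.one (𝒱 := 𝒱))
  rw [add_zero, mul_one] at this
  exact Submodule.subset_span this

/-! ### The Borcherds relations and the current algebra -/

/-- The partial sums of the series, for `u` of weight `r` and `v` of weight `s`,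
`B_{a,b,n}(u, v) = ∑_i binom(a+r-1, i) J_{a+b+n}(u_(n+i) v)
  - ∑_i (-1)^i binom(n, i) J_{a+n-i}(u) J_{b+i}(v)
  + (-1)^n ∑_i (-1)^i binom(n, i) J_{b+n-i}(v) J_{a+i}(u)`.
Here `u_(n+i) v` has weight `r+s-(n+i)-1`. -/
def borcherdsPartialSum (r s a b n : ℤ) (u v : V) (N : ℕ) : 𝒱.Enveloping :=
  ∑ i ∈ Finset.range N,
    (Ring.choose (a + r - 1) i • 𝒱.J (r + s - (n + i) - 1) (a + b + n) (𝒱.op (n + i) u v)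
      - ((-1) ^ i * Ring.choose n i) • (𝒱.J r (a + n - i) u * 𝒱.J s (b + i) v)
      + ((n.negOnePow : ℤ) * ((-1) ^ i * Ring.choose n i)) •
          (𝒱.J s (b + n - i) v * 𝒱.J r (a + i) u))

theorem J_mul_J_mem {r s p q d : ℤ} {n : ℕ} {u v : V} (hu : u ∈ 𝒱.wt r) (hv : v ∈ 𝒱.wt s)
    (hd : p + q = -d) (hq : (n : ℤ) + 1 ≤ q) :
    𝒱.J r p u * 𝒱.J s q v ∈ lowProducts 𝒱.envelopingGr d n := by
  have h1 : 𝒱.J r p u * 𝒱.J s q v ∈ 𝒱.envelopingGr (d - -q) * 𝒱.envelopingGr (-q) := by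
    refine Submodule.mul_mem_mul ?_ (𝒱.J_mem q hv)
    have := 𝒱.J_mem p hu
    rwa [show d - -q = -p by omega]
  exact le_iSup_of_le (f := fun j : ℤ => ⨆ _ : j ≤ -(n : ℤ) - 1,
    𝒱.envelopingGr (d - j) * 𝒱.envelopingGr j) (-q) (le_iSup_of_le (by omega) le_rfl) h1

theorem borcherdsPartialSum_mem {r s : ℤ} (a b n : ℤ) {u v : V} (hu : u ∈ 𝒱.wt r)
    (hv : v ∈ 𝒱.wt s) :
    𝒱.borcherdsPartialSum r s a b n u v ∈ cauchySeq 𝒱.envelopingGr (-(a + b + n)) := by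
  constructor
  · intro N
    refine Submodule.sum_mem _ fun i _ => ?_
    refine add_mem (sub_mem ?_ ?_) ?_
    · refine zsmul_mem (𝒱.J_mem _ ?_) _
      exact 𝒱.op_mem _ _ _ _ _ hu hv
    · refine zsmul_mem ?_ _
      have := SetLike.mul_mem_graded (𝒱.J_mem (a + n - i) hu) (𝒱.J_mem (b + i) hv)
      rwa [show -(a + n - i) + -(b + i) = -(a + b + n) by ring] at this
    · refine zsmul_mem ?_ _
      have := SetLike.mul_mem_graded (𝒱.J_mem (b + n - i) hv) (𝒱.J_mem (a + i) hu)
      rwa [show -(b + n - i) + -(a + i) = -(a + b + n) by ring] at this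
  · intro l
    obtain ⟨m, hm⟩ := 𝒱.wt_bounded
    let M : ℕ := ((m : ℤ) + r + s - n).toNat + ((l : ℤ) + 1 - b).toNat + ((l : ℤ) + 1 - a).toNat
    have hstep : ∀ N ≥ M, ∀ N' ≥ N, 𝒱.borcherdsPartialSum r s a b n u v N'
        - 𝒱.borcherdsPartialSum r s a b n u v N
          ∈ lowProducts 𝒱.envelopingGr (-(a + b + n)) l := by
      intro N hN N' hN'
      rw [borcherdsPartialSum, borcherdsPartialSum, Finset.sum_range_sub_sum_range hN']
      refine Submodule.sum_mem _ fun i hi => ?_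
      have hi' : M ≤ i := hN.trans (Finset.mem_filter.1 hi).2
      have hz : 𝒱.op (n + i) u v = 0 := by
        have h1 := 𝒱.op_mem (n + i) r s u v hu hv
        rw [hm _ (by omega)] at h1
        exact (Submodule.mem_bot k).1 h1
      refine add_mem (sub_mem ?_ ?_) ?_
      · rw [hz]
        simp [J, lieMode]
      · exact zsmul_mem (𝒱.J_mul_J_mem hu hv (by ring) (by omega)) _
      · exact zsmul_mem (𝒱.J_mul_J_mem hv hu (by ring) (by omega)) _
    refine ⟨M, fun i hi j hj => ?_⟩
    rcases le_total i j with h | h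
    · rw [← neg_mem_iff, neg_sub]
      exact hstep i hi j h
    · exact hstep j hj i h

/-- The completion `𝕌̂` of `𝕌`. -/
abbrev EnvelopingHat : Type _ := DegreewiseCompletion 𝒱.envelopingGr

/-- The element `B_{a,b,n}(u, v)` of `𝕌̂`, for `u` of weight `r` and `v` of weight `s`. -/
def borcherdsElt {r s : ℤ} (a b n : ℤ) {u v : V} (hu : u ∈ 𝒱.wt r) (hv : v ∈ 𝒱.wt s) :
    𝒱.EnvelopingHat :=
  DegreewiseCompletion.lim 𝒱.envelopingGr _ (𝒱.borcherdsPartialSum_mem a b n hu hv)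

/-- The set of all `B_{a,b,n}(u, v)`. -/
def borcherdsSet : Set 𝒱.EnvelopingHat :=
  {x | ∃ (r s a b n : ℤ) (u v : V) (hu : u ∈ 𝒱.wt r) (hv : v ∈ 𝒱.wt s),
    𝒱.borcherdsElt a b n hu hv = x}

/-- The current algebra `U(V)`: the quotient of `𝕌̂` by the degreewise closure of the two-sided
ideal generated by all `B_{a,b,n}(u, v)`. -/
abbrev CurrentAlgebra : Type _ :=
  DegreewiseCompletion.ClosedQuotient 𝒱.envelopingGr 𝒱.borcherdsSet

/-- The grading and the degreewise topology of the current algebra. -/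
def currentTopology : DegreewiseTopology k 𝒱.CurrentAlgebra :=
  DegreewiseCompletion.quotientTopology 𝒱.envelopingGr 𝒱.borcherdsSet

end VertexOperatorAlgebra

end

noncomputable section

/-! Write `C_N(V)` for the span of all `u_(n) v` with `n ≤ -N`. The argument has two algebraic
inputs and a topological framework.

Inside `V`: `C_2`-finiteness implies that `V / C_N(V)` is finite-dimensional for every `N ≥ 2`
(`exists_fg_sup_modeSpan`). If `F + C_N(V) = V`, then `F + F_(-N) F + C_(N+1)(V) = V`, because the
iterate formula puts `u_(-N) (v_(-N) w)` in `C_(N+1)(V)`.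

Inside `U(V)`, modulo `I_l`: a product `J_p(u) J_q(v)` vanishes once `q > l`. The Borcherds relation
with `a = l + 1` loses its second series of products and expresses `J_p(u) J_q(v)` through single
modes and products with larger `q`, so in degree `d` every element is congruent to a single mode
`J_{-d}(v)` (`envelopingGr_le_sup`). If `n` is so negative that `b > l` as well, both series of
products vanish and the relation says that `u_(n) v` is congruent, in the kernel of `v ↦ J_{-d}(v)`
modulo `I_l`, to vectors of lower weight (`op_mem_sup`). As the weights are bounded below, induction
on the weight shows that the vectors spanning `V` modulo `C_N(V)` also span it modulo this kernel
(`exists_fg_sup_eq_top`).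

For the framework, commutation with `J_0(ω)` acts on degree `d` as the scalar `d`. In characteristic
zero the homogeneous subspaces are therefore independent, in `𝕌` as well as in its completion and
the quotient. Completeness passes to the quotient by lifting Cauchy sequences, and separatedness
holds because the ideal is closed. Density of `𝕌` identifies the quotient neighbourhoods with the
`I_n` (`quotient_canonicalIdeal`). -/

theorem finsum_mem_submodule {k M ι : Type*} [Ring k] [AddCommGroup M] [Module k M]
    (K : Submodule k M) {f : ι → M} (h : ∀ i, f i ∈ K) : ∑ᶠ i, f i ∈ K :=
  finsum_induction (p := (· ∈ K)) K.zero_mem (fun _ _ => K.add_mem) h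

theorem mem_of_finsum_mem {k M ι : Type*} [Ring k] [AddCommGroup M] [Module k M]
    (K : Submodule k M) {f : ι → M} (hf : f.support.Finite) (hs : ∑ᶠ i, f i ∈ K) (i₀ : ι)
    (h : ∀ i, i ≠ i₀ → f i ∈ K) : f i₀ ∈ K := by
  classical
  have h1 : ∑ᶠ i, f i = ∑ i ∈ insert i₀ hf.toFinset, f i :=
    finsum_eq_sum_of_support_subset _ (by intro i hi; simp_all)
  rw [← Finset.add_sum_erase _ _ (Finset.mem_insert_self _ _)] at h1
  rw [h1] at hs
  refine (Submodule.add_mem_iff_left K (Submodule.sum_mem _ fun i hi => ?_)).1 hs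
  exact h i (Finset.ne_of_mem_erase hi)

/-! ### Weight projections and special cases of the Borcherds identity -/

namespace VertexOperatorAlgebra

variable {k V : Type*} [Field k] [AddCommGroup V] [Module k V] (𝒱 : VertexOperatorAlgebra k V)

theorem iSup_wt : ⨆ r, 𝒱.wt r = ⊤ := 𝒱.isInternal.submodule_iSup_eq_top

/-- The linear map which agrees with `f r` on `V[r]`. -/
def glue {W : Type*} [AddCommGroup W] [Module k W] (f : ℤ → V →ₗ[k] W) : V →ₗ[k] W :=
  DirectSum.toModule k ℤ W (fun r => f r ∘ₗ (𝒱.wt r).subtype) ∘ₗ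
    (LinearEquiv.ofBijective (DirectSum.coeLinearMap 𝒱.wt) 𝒱.isInternal).symm.toLinearMap

theorem glue_apply {W : Type*} [AddCommGroup W] [Module k W] (f : ℤ → V →ₗ[k] W) {r : ℤ} {u : V}
    (hu : u ∈ 𝒱.wt r) : 𝒱.glue f u = f r u := by
  have h : (LinearEquiv.ofBijective (DirectSum.coeLinearMap 𝒱.wt) 𝒱.isInternal).symm u =
      DirectSum.lof k ℤ (fun r => 𝒱.wt r) r ⟨u, hu⟩ := by
    rw [LinearEquiv.symm_apply_eq]
    exact (DirectSum.coeLinearMap_lof 𝒱.wt r ⟨u, hu⟩).symm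
  simp [glue, h]

/-- The projection of `V` onto `V[r]`. -/
def wtProj (r : ℤ) : V →ₗ[k] V := 𝒱.glue fun s => if s = r then LinearMap.id else 0

theorem wtProj_self {r : ℤ} {u : V} (hu : u ∈ 𝒱.wt r) : 𝒱.wtProj r u = u := by
  simp [wtProj, 𝒱.glue_apply _ hu]

theorem wtProj_of_ne {r s : ℤ} {u : V} (hu : u ∈ 𝒱.wt s) (h : s ≠ r) : 𝒱.wtProj r u = 0 := by
  simp [wtProj, 𝒱.glue_apply _ hu, h]

theorem mem_of_homogeneous {W : Type*} [AddCommGroup W] [Module k W] (f : V →ₗ[k] W)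
    (P : Submodule k W) (h : ∀ r, ∀ u ∈ 𝒱.wt r, f u ∈ P) (u : V) : f u ∈ P := by
  have : (⊤ : Submodule k V) ≤ P.comap f := by
    rw [← 𝒱.iSup_wt]
    exact iSup_le h
  exact this (Submodule.mem_top (x := u))

theorem mem_of_homogeneous₂ {W : Type*} [AddCommGroup W] [Module k W] (f : V →ₗ[k] V →ₗ[k] W)
    (P : Submodule k W) (h : ∀ r s, ∀ u ∈ 𝒱.wt r, ∀ v ∈ 𝒱.wt s, f u v ∈ P) (u v : V) :
    f u v ∈ P :=
  𝒱.mem_of_homogeneous (f.flip v) P (fun r u hu =>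
    𝒱.mem_of_homogeneous (f u) P (fun s v hv => h r s u hu v hv) v) u

/-- The axioms give this truncation for homogeneous vectors only. The general case makes the sums of
the iterate formula finite for arbitrary vectors. -/
theorem exists_op_eq_zero (u v : V) : ∃ M : ℤ, ∀ n ≥ M, 𝒱.op n u v = 0 := by
  obtain ⟨m, hm⟩ := 𝒱.wt_bounded
  have hu : u ∈ ⨆ r, 𝒱.wt r := 𝒱.iSup_wt ▸ Submodule.mem_top
  have hv : v ∈ ⨆ r, 𝒱.wt r := 𝒱.iSup_wt ▸ Submodule.mem_top
  induction hu using Submodule.iSup_induction' with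
  | zero => exact ⟨0, fun n _ => by simp⟩
  | add x y _ _ hx hy =>
    obtain ⟨M, hM⟩ := hx
    obtain ⟨M', hM'⟩ := hy
    exact ⟨max M M', fun n hn => by
      simp [hM n (le_trans (le_max_left _ _) hn), hM' n (le_trans (le_max_right _ _) hn)]⟩
  | mem r u hu =>
    induction hv using Submodule.iSup_induction' with
    | zero => exact ⟨0, fun n _ => by simp⟩
    | add x y _ _ hx hy =>
      obtain ⟨M, hM⟩ := hx
      obtain ⟨M', hM'⟩ := hy
      exact ⟨max M M', fun n hn => by
        simp [hM n (le_trans (le_max_left _ _) hn), hM' n (le_trans (le_max_right _ _) hn)]⟩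
    | mem s v hv =>
      refine ⟨r + s + m, fun n hn => ?_⟩
      have h1 := 𝒱.op_mem n r s u v hu hv
      rw [hm _ (by omega)] at h1
      exact (Submodule.mem_bot k).1 h1

/-- Borcherds' commutator formula. -/
theorem op_commutator (p q : ℤ) (u v w : V) :
    ∑ᶠ i : ℕ, Ring.choose p i • 𝒱.op (p + q - i) (𝒱.op i u v) w =
      𝒱.op p u (𝒱.op q v w) - 𝒱.op q v (𝒱.op p u w) := by
  have h := 𝒱.borcherds p q 0 u v w
  rw [finsum_eq_single (fun i : ℕ => ((-1) ^ i * Ring.choose (0 : ℤ) i) • _) 0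
    (fun i hi => by simp [Ring.choose_zero_ite, hi])] at h
  simpa using h

/-- Borcherds' iterate formula. -/
theorem op_iterate (q r : ℤ) (u v w : V) :
    𝒱.op q (𝒱.op r u v) w = ∑ᶠ i : ℕ, ((-1) ^ i * Ring.choose r i) •
        (𝒱.op (r - i) u (𝒱.op (q + i) v w)
          - (r.negOnePow : ℤ) • 𝒱.op (q + r - i) v (𝒱.op i u w)) := by
  have h := 𝒱.borcherds 0 q r u v w
  rw [finsum_eq_single (fun i : ℕ => Ring.choose (0 : ℤ) i • _) 0
    (fun i hi => by simp [Ring.choose_zero_ite, hi])] at h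
  simpa using h

theorem finite_support_iterate (q r : ℤ) (u v w : V) :
    (Function.support fun i : ℕ => ((-1) ^ i * Ring.choose r i) •
        (𝒱.op (r - i) u (𝒱.op (q + i) v w)
          - (r.negOnePow : ℤ) • 𝒱.op (q + r - i) v (𝒱.op i u w))).Finite := by
  obtain ⟨M, hM⟩ := 𝒱.exists_op_eq_zero v w
  obtain ⟨M', hM'⟩ := 𝒱.exists_op_eq_zero u w
  refine (Finset.range ((M - q).toNat + M'.toNat)).finite_toSet.subset fun i hi => ?_
  by_contra h
  simp only [Finset.coe_range, Set.mem_Iio, not_lt] at h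
  refine hi ?_
  simp only
  rw [hM _ (by omega), hM' _ (by omega)]
  simp

/-! ### From `C_2`-finiteness to `C_N`-finiteness -/

/-- The span of all `u_(n) v` with `n ≤ -N`. -/
def modeSpan (N : ℕ) : Submodule k V :=
  Submodule.span k {x | ∃ (n : ℤ) (u v : V), n ≤ -(N : ℤ) ∧ 𝒱.op n u v = x}

theorem op_mem_modeSpan {N : ℕ} {n : ℤ} (h : n ≤ -(N : ℤ)) (u v : V) :
    𝒱.op n u v ∈ 𝒱.modeSpan N :=
  Submodule.subset_span ⟨n, u, v, h, rfl⟩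

/-- Commuting `u_(j)` past `a_(n)` with `n ≤ -N` produces only modes of index `j + n - i`, which is
at most `-N` because `j < 0`. -/
theorem op_mem_modeSpan_of_mem {N : ℕ} {j : ℤ} (hj : j < 0) (u : V) {w : V}
    (hw : w ∈ 𝒱.modeSpan N) : 𝒱.op j u w ∈ 𝒱.modeSpan N := by
  have : 𝒱.modeSpan N ≤ (𝒱.modeSpan N).comap (𝒱.op j u) := by
    refine Submodule.span_le.2 ?_
    rintro _ ⟨n, a, b, hn, rfl⟩
    have h := 𝒱.op_commutator j n u a b
    rw [eq_sub_iff_add_eq] at h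
    change 𝒱.op j u (𝒱.op n a b) ∈ 𝒱.modeSpan N
    rw [← h]
    exact add_mem (finsum_mem_submodule _ fun i =>
      zsmul_mem (𝒱.op_mem_modeSpan (by omega) _ _) _) (𝒱.op_mem_modeSpan hn _ _)
  exact this hw

/-- This is the term `i = 1` in the expansion of `(u_(1-N) v)_(-N-1) w`. That vector and all the
other terms lie in `C_(N+1)(V)`. -/
theorem op_op_mem_modeSpan [CharZero k] {N : ℕ} (hN : 2 ≤ N) (u v w : V) :
    𝒱.op (-N) u (𝒱.op (-N) v w) ∈ 𝒱.modeSpan (N + 1) := by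
  have h := mem_of_finsum_mem (𝒱.modeSpan (N + 1))
    (𝒱.finite_support_iterate (-N - 1) (1 - N) u v w)
    (by rw [← op_iterate]; exact 𝒱.op_mem_modeSpan (by omega) _ _) 1 (by
      intro i hi
      refine zsmul_mem (sub_mem ?_ (zsmul_mem (𝒱.op_mem_modeSpan (by omega) _ _) _)) _
      rcases Nat.eq_zero_or_pos i with rfl | h0
      · exact 𝒱.op_mem_modeSpan_of_mem (by push_cast; omega) _ (𝒱.op_mem_modeSpan (by omega) _ _)
      · exact 𝒱.op_mem_modeSpan (by omega) _ _)
  simp only [pow_one, Ring.choose_one_right, smul_sub] at h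
  have h2 := (Submodule.sub_mem_iff_left _ (zsmul_mem (zsmul_mem
    (𝒱.op_mem_modeSpan (by omega) _ _) _) _)).1 h
  rw [show (1 : ℤ) - N - (1 : ℕ) = -N by push_cast; ring,
    show (-N : ℤ) - 1 + (1 : ℕ) = -N by push_cast; ring, ← Int.cast_smul_eq_zsmul k] at h2
  -- The coefficient is `-(1 - N) = N - 1`, nonzero since `N ≥ 2` and the characteristic is zero.
  refine (Submodule.smul_mem_iff _ ?_).1 h2
  rw [Int.cast_ne_zero]
  omega

theorem op_mem_modeSpan_succ_of_mem_left [CharZero k] {N : ℕ} (hN : 2 ≤ N) {u : V}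
    (hu : u ∈ 𝒱.modeSpan N) (w : V) : 𝒱.op (-N) u w ∈ 𝒱.modeSpan (N + 1) := by
  have : 𝒱.modeSpan N ≤ (𝒱.modeSpan (N + 1)).comap ((𝒱.op (-N)).flip w) := by
    refine Submodule.span_le.2 ?_
    rintro _ ⟨n, a, b, hn, rfl⟩
    change 𝒱.op (-N) (𝒱.op n a b) w ∈ 𝒱.modeSpan (N + 1)
    rw [op_iterate]
    refine finsum_mem_submodule _ fun i =>
      zsmul_mem (sub_mem ?_ (zsmul_mem (𝒱.op_mem_modeSpan (by omega) _ _) _)) _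
    -- Only the leading term with `n = -N` fails to have an outer mode of index at most `-(N + 1)`;
    -- it is a double `(-N)`-product.
    rcases (show n - i = -N ∧ i = 0 ∨ n - i ≤ -((N + 1 : ℕ) : ℤ) by omega) with ⟨h, rfl⟩ | h
    · rw [h]
      simpa using 𝒱.op_op_mem_modeSpan hN a b w
    · exact 𝒱.op_mem_modeSpan h _ _
  exact this hu

theorem op_mem_modeSpan_succ_of_mem_right [CharZero k] {N : ℕ} (hN : 2 ≤ N) (u : V) {w : V}
    (hw : w ∈ 𝒱.modeSpan N) : 𝒱.op (-N) u w ∈ 𝒱.modeSpan (N + 1) := by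
  have : 𝒱.modeSpan N ≤ (𝒱.modeSpan (N + 1)).comap (𝒱.op (-N) u) := by
    refine Submodule.span_le.2 ?_
    rintro _ ⟨n, a, b, hn, rfl⟩
    change 𝒱.op (-N) u (𝒱.op n a b) ∈ 𝒱.modeSpan (N + 1)
    rcases (show n = -N ∨ n ≤ -((N + 1 : ℕ) : ℤ) by omega) with rfl | h
    · exact 𝒱.op_op_mem_modeSpan hN u a b
    · exact 𝒱.op_mem_modeSpan_of_mem (by omega) _ (𝒱.op_mem_modeSpan h _ _)
  exact this hw

/-- Modulo `C_(N+1)(V)`, the product `u_(-N) v` depends only on the classes of `u` and `v` modulo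
`C_N(V)`, so adjoining the products of elements of `F` suffices. -/
theorem exists_fg_sup_modeSpan_succ [CharZero k] {N : ℕ} (hN : 2 ≤ N) {F : Submodule k V}
    (hF : F.FG) (h : F ⊔ 𝒱.modeSpan N = ⊤) :
    ∃ G : Submodule k V, G.FG ∧ G ⊔ 𝒱.modeSpan (N + 1) = ⊤ := by
  refine ⟨F ⊔ Submodule.map₂ (𝒱.op (-N)) F F, hF.sup (hF.map₂ _ hF), ?_⟩
  rw [eq_top_iff, ← h, sup_assoc]
  refine sup_le_sup_left (Submodule.span_le.2 ?_) _
  rintro _ ⟨n, a, b, hn, rfl⟩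
  rcases (show n = -N ∨ n ≤ -((N + 1 : ℕ) : ℤ) by omega) with rfl | hn'
  · obtain ⟨a₁, ha₁, a₂, ha₂, rfl⟩ := Submodule.mem_sup.1 (h.ge (Submodule.mem_top (x := a)))
    obtain ⟨b₁, hb₁, b₂, hb₂, rfl⟩ := Submodule.mem_sup.1 (h.ge (Submodule.mem_top (x := b)))
    rw [map_add (𝒱.op (-N) (a₁ + a₂)), map_add (𝒱.op (-N)), LinearMap.add_apply, add_assoc,
      ← map_add]
    exact Submodule.add_mem_sup (Submodule.apply_mem_map₂ _ ha₁ hb₁)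
      (add_mem (𝒱.op_mem_modeSpan_succ_of_mem_left hN ha₂ _)
        (𝒱.op_mem_modeSpan_succ_of_mem_right hN _ hb₂))
  · exact Submodule.mem_sup_right (𝒱.op_mem_modeSpan hn' _ _)

theorem exists_fg_sup_modeSpan [CharZero k] (hV : 𝒱.IsC2Finite) {N : ℕ} (hN : 2 ≤ N) :
    ∃ F : Submodule k V, F.FG ∧ F ⊔ 𝒱.modeSpan N = ⊤ := by
  induction N, hN using Nat.le_induction with
  | base =>
    have h2 : 𝒱.C2 = 𝒱.modeSpan 2 := rfl
    have : FiniteDimensional k (V ⧸ 𝒱.modeSpan 2) := hV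
    obtain ⟨F, hF⟩ := (𝒱.modeSpan 2).exists_isCompl
    refine ⟨F, ?_, hF.symm.sup_eq_top⟩
    rw [← Module.Finite.iff_fg]
    exact Module.Finite.equiv (Submodule.quotientEquivOfIsCompl _ _ hF)
  | succ N hN ih =>
    obtain ⟨F, hF, h⟩ := ih
    exact 𝒱.exists_fg_sup_modeSpan_succ hN hF h

/-! ### Finite codimension by induction on the weight -/

/-- The sum of the `V[t]` with `t < r`. -/
def wtLT (r : ℤ) : Submodule k V := ⨆ t : ℤ, ⨆ _ : t < r, 𝒱.wt t

theorem wt_le_wtLT {t r : ℤ} (h : t < r) : 𝒱.wt t ≤ 𝒱.wtLT r :=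
  le_iSup_of_le t (le_iSup_of_le h le_rfl)

/-- The homogeneous vectors span the finite-dimensional quotient by `C_N(V)`, so finitely many of
them do. Homogeneity makes their span stable under the weight projections. -/
theorem exists_homogeneous_sup_modeSpan {N : ℕ} {F : Submodule k V} (hF : F.FG)
    (h : F ⊔ 𝒱.modeSpan N = ⊤) :
    ∃ t : Finset V, (∀ x ∈ t, ∃ r, x ∈ 𝒱.wt r) ∧ Submodule.span k t ⊔ 𝒱.modeSpan N = ⊤ := by
  classical
  have hspan : Submodule.span k (⋃ r, (𝒱.wt r : Set V)) = ⊤ := by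
    rw [Submodule.span_iUnion]
    simpa using 𝒱.iSup_wt
  have hmap : Submodule.span k ((𝒱.modeSpan N).mkQ '' ⋃ r, (𝒱.wt r : Set V)) = ⊤ := by
    rw [Submodule.span_image, hspan, Submodule.map_top, Submodule.range_mkQ]
  have hFG : (⊤ : Submodule k (V ⧸ 𝒱.modeSpan N)).FG := by
    have := hF.map (𝒱.modeSpan N).mkQ
    rwa [show F.map (𝒱.modeSpan N).mkQ = ⊤ by
      rw [← Submodule.range_mkQ, LinearMap.range_eq_map, ← h, Submodule.map_sup,
        Submodule.mkQ_map_self, sup_bot_eq]] at this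
  rw [← hmap, Submodule.fg_span_iff_fg_span_finset_subset] at hFG
  obtain ⟨s, hs, hs'⟩ := hFG
  obtain ⟨t, ht, rfl⟩ := Finset.subset_set_image_iff.1 hs
  refine ⟨t, fun x hx => by simpa using ht hx, ?_⟩
  rw [hmap, Finset.coe_image, Submodule.span_image] at hs'
  have := congrArg (Submodule.comap (𝒱.modeSpan N).mkQ) hs'
  rw [Submodule.comap_top, Submodule.comap_map_eq, Submodule.ker_mkQ] at this
  exact this.symm

/-- If `V = F + C_N(V)` for some `F` of finite dimension, and modulo `K` the generators of
`C_N(V)` can be replaced by vectors of lower weight, then `K` has finite codimension. -/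
theorem exists_fg_sup_eq_top {N : ℕ} {F : Submodule k V} (hF : F.FG)
    (h : F ⊔ 𝒱.modeSpan N = ⊤) (K : Submodule k V)
    (hK : ∀ (r s n : ℤ) (u v : V), u ∈ 𝒱.wt r → v ∈ 𝒱.wt s → n ≤ -(N : ℤ) →
      𝒱.op n u v ∈ K ⊔ 𝒱.wtLT (r + s - n - 1)) :
    ∃ G : Submodule k V, G.FG ∧ G ⊔ K = ⊤ := by
  obtain ⟨t, ht, htop⟩ := 𝒱.exists_homogeneous_sup_modeSpan hF h
  refine ⟨Submodule.span k t, Submodule.fg_span t.finite_toSet, ?_⟩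
  obtain ⟨m, hm⟩ := 𝒱.wt_bounded
  have hspan (r : ℤ) : (Submodule.span k (t : Set V)).map (𝒱.wtProj r) ≤ Submodule.span k t := by
    rw [Submodule.map_span, Submodule.span_le]
    rintro _ ⟨x, hx, rfl⟩
    obtain ⟨s, hs⟩ := ht x hx
    by_cases hsr : s = r
    · subst hsr
      rw [𝒱.wtProj_self hs]
      exact Submodule.subset_span hx
    · rw [𝒱.wtProj_of_ne hs hsr]
      exact zero_mem _
  -- `K` need not be graded, so the weight `r` part is extracted from `C_N(V)` before the hypothesis
  -- on `K` is applied.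
  have hmode (r : ℤ) : (𝒱.modeSpan N).map (𝒱.wtProj r) ≤ K ⊔ 𝒱.wtLT r := by
    rw [modeSpan, Submodule.map_span, Submodule.span_le]
    rintro _ ⟨_, ⟨n, u, v, hn, rfl⟩, rfl⟩
    refine 𝒱.mem_of_homogeneous₂ ((𝒱.op n).compr₂ (𝒱.wtProj r)) _ (fun r' s u hu v hv => ?_) u v
    rw [LinearMap.compr₂_apply]
    have h1 := 𝒱.op_mem n _ _ _ _ hu hv
    by_cases hsr : r' + s - n - 1 = r
    · subst hsr
      rw [𝒱.wtProj_self h1]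
      exact hK _ _ _ _ _ hu hv hn
    · rw [𝒱.wtProj_of_ne h1 hsr]
      exact zero_mem _
  -- The induction on the weight starts below `-m`, where `V[r] = 0`.
  have key : ∀ (j : ℕ) (r : ℤ), r < -m + j → 𝒱.wt r ≤ Submodule.span k t ⊔ K := by
    intro j
    induction j with
    | zero =>
      intro r hr
      rw [hm r (by simpa using hr)]
      exact bot_le
    | succ j ih =>
      intro r hr x hx
      obtain ⟨y, hy, c, hc, hyc⟩ := Submodule.mem_sup.1 (htop.ge (Submodule.mem_top (x := x)))
      have h1 : x = 𝒱.wtProj r y + 𝒱.wtProj r c := by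
        rw [← map_add, hyc, 𝒱.wtProj_self hx]
      rw [h1]
      refine add_mem (Submodule.mem_sup_left (hspan r ⟨y, hy, rfl⟩)) ?_
      refine (sup_le le_sup_right ?_ : K ⊔ 𝒱.wtLT r ≤ _) (hmode r ⟨c, hc, rfl⟩)
      exact iSup_le fun s => iSup_le fun hs => ih s (by push_cast at hr; omega)
  rw [eq_top_iff, ← 𝒱.iSup_wt]
  exact iSup_le fun r => key (m + r + 1).toNat r (by omega)

end VertexOperatorAlgebra

/-! ### Modes in `𝕌` and the degree operator `J_0(ω)` -/

namespace VertexOperatorAlgebra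

variable {k V : Type*} [Field k] [AddCommGroup V] [Module k V] (𝒱 : VertexOperatorAlgebra k V)

/-- The image of `u ⊗ t^n` in `𝕌`, as a linear function of `u`. -/
def mode (n : ℤ) : V →ₗ[k] 𝒱.Enveloping :=
  𝒱.toEnveloping.toLinearMap ∘ₗ TensorAlgebra.ι k ∘ₗ 𝒱.derivationRange.mkQ ∘ₗ
    (TensorProduct.mk k V (LaurentPolynomial k)).flip (LaurentPolynomial.T n)

theorem J_eq_mode (r n : ℤ) (u : V) : 𝒱.J r n u = 𝒱.mode (n + r - 1) u := rfl

theorem mode_commutator (u v : V) (m n : ℤ) :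
    𝒱.mode m u * 𝒱.mode n v - 𝒱.mode n v * 𝒱.mode m u =
      𝒱.toEnveloping (TensorAlgebra.ι k (𝒱.lieBracket u m v n)) := by
  have h := RingQuot.mkAlgHom_rel k (EnvelopingRel.bracket (𝒱 := 𝒱) u m v n)
  rw [map_sub, map_mul, map_mul] at h
  exact h

theorem mode_vac : 𝒱.mode (-1) 𝒱.vac = 1 :=
  (RingQuot.mkAlgHom_rel k (EnvelopingRel.vac (𝒱 := 𝒱))).trans (map_one _)

theorem mode_translation (u : V) (n : ℤ) :
    𝒱.mode n (𝒱.translation u) = -(n • 𝒱.mode (n - 1) u) := by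
  rw [eq_neg_iff_add_eq_zero]
  have h : 𝒱.derivationRange.mkQ (𝒱.translation u ⊗ₜ[k] LaurentPolynomial.T n
      + n • (u ⊗ₜ[k] (LaurentPolynomial.T (n - 1) : LaurentPolynomial k))) = 0 := by
    rw [Submodule.mkQ_apply, Submodule.Quotient.mk_eq_zero]
    exact Submodule.subset_span ⟨u, n, rfl⟩
  rw [map_add, map_zsmul] at h
  have h2 := congrArg (fun x => 𝒱.toEnveloping (TensorAlgebra.ι k x)) h
  simp only [map_add, map_zsmul, map_zero] at h2
  exact h2

/-- `J_0(ω)` acts on `J_n(v)` through the degree. -/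
theorem mode_omega_commutator {s : ℤ} {v : V} (hv : v ∈ 𝒱.wt s) (n : ℤ) :
    𝒱.mode 1 𝒱.omega * 𝒱.mode n v - 𝒱.mode n v * 𝒱.mode 1 𝒱.omega =
      ((s - n - 1 : ℤ) : k) • 𝒱.mode n v := by
  rw [mode_commutator]
  have h : 𝒱.lieBracket 𝒱.omega 1 v n =
      𝒱.lieMode (𝒱.op 0 𝒱.omega v) (1 + n) + 𝒱.lieMode (𝒱.op 1 𝒱.omega v) n := by
    rw [lieBracket, finsum_eq_sum_of_support_subset (s := Finset.range 2)]
    · simp [Finset.sum_range_succ]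
    · intro i hi
      by_contra h
      simp only [Finset.coe_range, Set.mem_Iio, not_lt] at h
      refine hi ?_
      have : Ring.choose (1 : ℤ) i = 0 := by
        rw [← Nat.cast_one, Ring.choose_natCast, Nat.choose_eq_zero_of_lt h]
        rfl
      simp [this]
  -- In `𝔤` the class of `Tv ⊗ t^(n+1)` is `-(n + 1)` times that of `v ⊗ t^n`; with the eigenvalue
  -- `s` of `ω_(1)` this gives `s - n - 1`.
  have h0 : 𝒱.op 0 𝒱.omega v = 𝒱.translation v := (𝒱.translation_eq v).symm
  rw [h, h0, (𝒱.mem_wt_iff s v).1 hv, map_add, map_add]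
  change 𝒱.mode (1 + n) (𝒱.translation v) + 𝒱.mode n ((s : k) • v) = _
  rw [mode_translation, map_smul, ← Int.cast_smul_eq_zsmul k, add_sub_cancel_left, ← neg_smul,
    ← add_smul]
  congr 1
  push_cast
  ring

/-- The commutator with `J_0(ω)` is a derivation, so the eigenvalues of the factors of a monomial
add up to its degree. -/
theorem omega_mul_sub {d : ℤ} {x : 𝒱.Enveloping} (hx : x ∈ 𝒱.envelopingGr d) :
    𝒱.J 2 0 𝒱.omega * x - x * 𝒱.J 2 0 𝒱.omega = (d : k) • x := by
  have key : ∀ {d x}, 𝒱.IsMonomial d x →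
      𝒱.J 2 0 𝒱.omega * x - x * 𝒱.J 2 0 𝒱.omega = (d : k) • x := by
    intro d x hx
    induction hx with
    | one => simp
    | mul r n d u x hu hx ih =>
      have h := 𝒱.mode_omega_commutator hu (n + r - 1)
      rw [show r - (n + r - 1) - 1 = -n by ring] at h
      rw [J_eq_mode, show (0 : ℤ) + 2 - 1 = 1 by norm_num] at ih ⊢
      rw [J_eq_mode]
      calc _ = (𝒱.mode 1 𝒱.omega * 𝒱.mode (n + r - 1) u
              - 𝒱.mode (n + r - 1) u * 𝒱.mode 1 𝒱.omega) * x
            + 𝒱.mode (n + r - 1) u * (𝒱.mode 1 𝒱.omega * x - x * 𝒱.mode 1 𝒱.omega) := by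
            noncomm_ring
        _ = _ := by
            rw [h, ih, smul_mul_assoc, mul_smul_comm, ← add_smul]
            push_cast
            rfl
  have hle : 𝒱.envelopingGr d ≤ LinearMap.ker (LinearMap.mulLeft k (𝒱.J 2 0 𝒱.omega)
      - LinearMap.mulRight k (𝒱.J 2 0 𝒱.omega) - (d : k) • LinearMap.id) := by
    refine Submodule.span_le.2 fun y hy => ?_
    simpa [sub_eq_zero] using key hy
  simpa [sub_eq_zero] using hle hx

theorem iSup_envelopingGr : ⨆ d, 𝒱.envelopingGr d = ⊤ := by
  let S : Subalgebra k 𝒱.Enveloping := (⨆ d, 𝒱.envelopingGr d).toSubalgebra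
    (Submodule.mem_iSup_of_mem 0 SetLike.GradedOne.one_mem) (by
      intro x y hx hy
      have h : (⨆ d, 𝒱.envelopingGr d) * (⨆ d, 𝒱.envelopingGr d) ≤ ⨆ d, 𝒱.envelopingGr d := by
        simp only [Submodule.iSup_mul, Submodule.mul_iSup]
        exact iSup_le fun d => iSup_le fun e => (gr_mul_gr_le _ _ _).trans
          (le_iSup 𝒱.envelopingGr (e + d))
      exact h (Submodule.mul_mem_mul hx hy))
  have hmode : ∀ n u, 𝒱.mode n u ∈ S := by
    intro n u
    refine 𝒱.mem_of_homogeneous (𝒱.mode n) (Subalgebra.toSubmodule S) (fun r u hu => ?_) u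
    have h := 𝒱.J_mem (n + 1 - r) hu
    rw [J_eq_mode, show n + 1 - r + r - 1 = n by ring] at h
    exact Submodule.mem_iSup_of_mem _ h
  have hι : ∀ x, 𝒱.toEnveloping (TensorAlgebra.ι k x) ∈ S := by
    intro x
    obtain ⟨y, rfl⟩ := 𝒱.derivationRange.mkQ_surjective x
    induction y using TensorProduct.induction_on with
    | zero => simp
    | add a b ha hb => simpa only [map_add] using add_mem ha hb
    | tmul u f =>
      induction f using LaurentPolynomial.induction_on' with
      | add p q hp hq => simpa only [TensorProduct.tmul_add, map_add] using add_mem hp hq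
      | C_mul_T n a =>
        rw [← LaurentPolynomial.smul_eq_C_mul, TensorProduct.tmul_smul, map_smul, map_smul,
          map_smul]
        exact S.smul_mem (hmode n u) a
  rw [eq_top_iff]
  rintro x -
  obtain ⟨y, rfl⟩ := RingQuot.mkAlgHom_surjective k 𝒱.EnvelopingRel x
  change 𝒱.toEnveloping y ∈ S
  induction y using TensorAlgebra.induction with
  | algebraMap r => rw [AlgHom.commutes]; exact S.algebraMap_mem r
  | ι x => exact hι x
  | mul a b ha hb => rw [map_mul]; exact mul_mem ha hb
  | add a b ha hb => rw [map_add]; exact add_mem ha hb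

/-! ### Reduction of products to single modes -/

/-- The linear map sending `u ∈ V[r]` to `J_n(u)` for every `r`. -/
def Jmap (n : ℤ) : V →ₗ[k] 𝒱.Enveloping := 𝒱.glue fun r => 𝒱.mode (n + r - 1)

theorem Jmap_apply {r : ℤ} (n : ℤ) {u : V} (hu : u ∈ 𝒱.wt r) : 𝒱.Jmap n u = 𝒱.J r n u :=
  𝒱.glue_apply _ hu

/-- A family of subspaces `R d` of `𝕌` behaving like `I_l`: it contains the elements of
`lowProducts d l`, is stable under left multiplication, and contains the partial sums of the
Borcherds relations which are long enough. -/
structure IsBorcherdsStable (l : ℕ) (R : ℤ → Submodule k 𝒱.Enveloping) : Prop where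
  low : ∀ d, lowProducts 𝒱.envelopingGr d l ≤ R d
  mul_mem : ∀ d e, ∀ x ∈ 𝒱.envelopingGr e, ∀ y ∈ R d, x * y ∈ R (e + d)
  borcherds : ∀ (r s a b n : ℤ) (u v : V), u ∈ 𝒱.wt r → v ∈ 𝒱.wt s →
    ∃ M, ∀ N ≥ M, 𝒱.borcherdsPartialSum r s a b n u v N ∈ R (-(a + b + n))

namespace IsBorcherdsStable

variable {𝒱} {l : ℕ} {R : ℤ → Submodule k 𝒱.Enveloping}

theorem J_mul_J_mem (hR : 𝒱.IsBorcherdsStable l R) {r s p q d : ℤ} {u v : V} (hu : u ∈ 𝒱.wt r)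
    (hv : v ∈ 𝒱.wt s) (hd : p + q = -d) (hq : (l : ℤ) + 1 ≤ q) :
    𝒱.J r p u * 𝒱.J s q v ∈ R d :=
  hR.low d (𝒱.J_mul_J_mem hu hv hd hq)

/-- Since `a ≥ l + 1`, every product `J_{b+n-i}(v) J_{a+i}(u)` of the relation already lies in `R
d`. The range is `N + 1` so that the term `i = 0` can be split off. -/
theorem exists_sum_sub_sum_mem (hR : 𝒱.IsBorcherdsStable l R) {r s a b n d : ℤ} {u v : V}
    (hu : u ∈ 𝒱.wt r) (hv : v ∈ 𝒱.wt s) (ha : (l : ℤ) + 1 ≤ a) (hd : a + b + n = -d) :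
    ∃ N : ℕ,
      ∑ i ∈ Finset.range (N + 1), (Ring.choose (a + r - 1) i : ℤ) • 𝒱.Jmap (-d) (𝒱.op (n + i) u v)
      - ∑ i ∈ Finset.range (N + 1),
        ((-1) ^ i * Ring.choose n i : ℤ) • (𝒱.J r (a + n - i) u * 𝒱.J s (b + i) v) ∈ R d := by
  obtain ⟨M, hM⟩ := hR.borcherds r s a b n u v hu hv
  refine ⟨M, ?_⟩
  have h := hM (M + 1) (by omega)
  rw [borcherdsPartialSum, Finset.sum_add_distrib, Finset.sum_sub_distrib, hd, neg_neg] at h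
  simp only [𝒱.Jmap_apply (-d) (𝒱.op_mem _ _ _ _ _ hu hv)]
  refine (Submodule.add_mem_iff_left _ (Submodule.sum_mem _ fun i _ => ?_)).1 h
  exact zsmul_mem (hR.J_mul_J_mem hv hu (by omega) (by omega)) _

/-- Induction on `l + 1 - q`: the relation trades `J_p(u) J_q(v)` for single modes and the products
`J_{p-i}(u) J_{q+i}(v)` with `i ≥ 1`. Once `q ≥ l + 1` the product lies in `R d`. -/
theorem J_mul_J_mem_sup (hR : 𝒱.IsBorcherdsStable l R) {r s : ℤ} {u v : V} (hu : u ∈ 𝒱.wt r)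
    (hv : v ∈ 𝒱.wt s) (d p q : ℤ) (hd : p + q = -d) :
    𝒱.J r p u * 𝒱.J s q v ∈ LinearMap.range (𝒱.Jmap (-d)) ⊔ R d := by
  have key : ∀ (j : ℕ) (p q : ℤ), p + q = -d → (l : ℤ) + 1 - q ≤ j →
      𝒱.J r p u * 𝒱.J s q v ∈ LinearMap.range (𝒱.Jmap (-d)) ⊔ R d := by
    intro j
    induction j with
    | zero =>
      intro p q hd hq
      exact Submodule.mem_sup_right (hR.J_mul_J_mem hu hv hd (by omega))
    | succ j ih =>
      intro p q hd hq
      -- With `n = p - (l + 1)` the term `i = 0` of the product series is exactly `J_p(u) J_q(v)`,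
      -- with coefficient one.
      obtain ⟨N, hN⟩ := hR.exists_sum_sub_sum_mem (a := l + 1) (b := q) (n := p - (l + 1)) (d := d)
        hu hv le_rfl (by omega)
      have h1 := (Submodule.sub_mem_iff_right _ (Submodule.sum_mem _ fun i _ => zsmul_mem
        (Submodule.mem_sup_left (LinearMap.mem_range_self _ _)) _)).1
        ((le_sup_right : R d ≤ LinearMap.range (𝒱.Jmap (-d)) ⊔ R d) hN)
      rw [Finset.sum_range_succ'] at h1
      have h2 := (Submodule.add_mem_iff_right _ (Submodule.sum_mem _ fun i _ => zsmul_mem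
        (ih _ _ (by push_cast; omega) (by push_cast at hq ⊢; omega)) _)).1 h1
      simpa using h2
  exact key (l + 1 - q).toNat p q hd (Int.self_le_toNat _)

/-- Monomials collapse from the right: the tail becomes a single mode plus an element of `R`, and
stability of `R` under left multiplication lets the next factor be absorbed. -/
theorem envelopingGr_le_sup (hR : 𝒱.IsBorcherdsStable l R) (d : ℤ) :
    𝒱.envelopingGr d ≤ LinearMap.range (𝒱.Jmap (-d)) ⊔ R d := by
  refine Submodule.span_le.2 fun x hx => ?_
  induction hx with
  | one =>
    refine Submodule.mem_sup_left ⟨𝒱.vac, ?_⟩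
    rw [𝒱.Jmap_apply _ 𝒱.vac_mem, J_eq_mode, ← mode_vac]
    norm_num
  | mul r n d u x hu hx ih =>
    obtain ⟨_, ⟨v, rfl⟩, y, hy, rfl⟩ := Submodule.mem_sup.1 ih
    rw [mul_add]
    refine add_mem ?_ (Submodule.mem_sup_right (hR.mul_mem _ _ _ (𝒱.J_mem n hu) _ hy))
    refine 𝒱.mem_of_homogeneous (LinearMap.mulLeft k (𝒱.J r n u) ∘ₗ 𝒱.Jmap (-d)) _
      (fun s v hv => ?_) v
    rw [LinearMap.comp_apply, LinearMap.mulLeft_apply, 𝒱.Jmap_apply _ hv]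
    exact hR.J_mul_J_mem_sup hu hv _ _ _ (by ring)

theorem op_mem_sup (hR : 𝒱.IsBorcherdsStable l R) {r s n d : ℤ} {u v : V} (hu : u ∈ 𝒱.wt r)
    (hv : v ∈ 𝒱.wt s) (hn : n ≤ -d - 2 * l - 2) :
    𝒱.op n u v ∈ (R d).comap (𝒱.Jmap (-d)) ⊔ 𝒱.wtLT (r + s - n - 1) := by
  -- The choice of `b` puts the relation in degree `d`, and the bound on `n` says precisely that `b
  -- ≥ l + 1`. Hence the remaining products `J_{a+n-i}(u) J_{b+i}(v)` are in `R d` too.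
  obtain ⟨N, hN⟩ := hR.exists_sum_sub_sum_mem (a := l + 1) (b := -d - n - (l + 1)) (n := n)
    (d := d) hu hv le_rfl (by ring)
  have h1 := (Submodule.sub_mem_iff_left _ (Submodule.sum_mem _ fun i _ => zsmul_mem
    (hR.J_mul_J_mem hu hv (by ring) (by omega)) _)).1 hN
  simp only [← map_zsmul (𝒱.Jmap (-d)), ← map_sum] at h1
  rw [Finset.sum_range_succ', ← Submodule.mem_comap] at h1
  -- Raising the mode index by `i + 1` lowers the weight by the same amount.
  have h2 : ∑ i ∈ Finset.range N, (Ring.choose ((l : ℤ) + 1 + r - 1) (i + 1) : ℤ) •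
      𝒱.op (n + (i + 1 : ℕ)) u v ∈ 𝒱.wtLT (r + s - n - 1) :=
    Submodule.sum_mem _ fun i _ => zsmul_mem
      (𝒱.wt_le_wtLT (by push_cast; omega) (𝒱.op_mem _ _ _ _ _ hu hv)) _
  have h3 := (Submodule.add_mem_iff_right _ (Submodule.mem_sup_right h2)).1
    (Submodule.mem_sup_left (T := 𝒱.wtLT (r + s - n - 1)) h1)
  simpa using h3

theorem exists_fg_envelopingGr_le [CharZero k] (hR : 𝒱.IsBorcherdsStable l R)
    (hV : 𝒱.IsC2Finite) (d : ℤ) :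
    ∃ P : Submodule k 𝒱.Enveloping, P.FG ∧ 𝒱.envelopingGr d ≤ P ⊔ R d := by
  -- The summand `2` secures `N ≥ 2`; the other makes `n ≤ -N` imply the bound required by
  -- `op_mem_sup`.
  obtain ⟨F, hF, h⟩ := 𝒱.exists_fg_sup_modeSpan hV (N := 2 + (d + 2 * l + 2).toNat) (by omega)
  obtain ⟨G, hG, h'⟩ := 𝒱.exists_fg_sup_eq_top hF h ((R d).comap (𝒱.Jmap (-d)))
    fun r s n u v hu hv hn => hR.op_mem_sup hu hv (by push_cast at hn; omega)
  refine ⟨G.map (𝒱.Jmap (-d)), hG.map _, (hR.envelopingGr_le_sup d).trans ?_⟩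
  refine sup_le ?_ le_sup_right
  rw [LinearMap.range_eq_map, ← h', Submodule.map_sup]
  exact sup_le_sup_left (Submodule.map_comap_le _ _) _

end IsBorcherdsStable

end VertexOperatorAlgebra

/-! ### Independence of homogeneous subspaces -/

theorem iSupIndep.mem_of_mem_iSup {ι k M : Type*} [Ring k] [AddCommGroup M] [Module k M]
    {S T : ι → Submodule k M} (hS : iSupIndep S) (hT : ∀ i, T i ≤ S i) {i : ι} {x : M}
    (hx : x ∈ ⨆ j, T j) (hi : x ∈ S i) : x ∈ T i := by
  have h1 : (⨆ j, T j) ≤ T i ⊔ ⨆ j, ⨆ _ : j ≠ i, S j := by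
    refine iSup_le fun j => ?_
    by_cases h : j = i
    · exact h ▸ le_sup_left
    · exact (hT j).trans (le_trans (le_iSup_of_le (f := fun j => ⨆ _ : j ≠ i, S j) j
        (le_iSup_of_le h le_rfl)) le_sup_right)
  have h2 : (T i ⊔ ⨆ j, ⨆ _ : j ≠ i, S j) ⊓ S i = T i := by
    rw [sup_inf_assoc_of_le _ (hT i), inf_comm, (disjoint_iff.1 (hS i)), sup_bot_eq]
  exact h2.le ⟨h1 hx, hi⟩

/-- An element `h` such that `A(d)` consists of eigenvectors of `ad h` with eigenvalue `d`. -/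
def IsHamiltonian {k A : Type*} [Field k] [Ring A] [Algebra k A] (gr : ℤ → Submodule k A)
    (h : A) : Prop :=
  ∀ d, ∀ x ∈ gr d, h * x - x * h = (d : k) • x

/-- Eigenspaces of the commutator with `h` for distinct eigenvalues are independent, and integers
stay distinct in `k`. -/
theorem IsHamiltonian.iSupIndep {k A : Type*} [Field k] [CharZero k] [Ring A] [Algebra k A]
    {gr : ℤ → Submodule k A} {h : A} (hh : IsHamiltonian gr h) : iSupIndep gr := by
  have h1 := Module.End.eigenspaces_iSupIndep (LinearMap.mulLeft k h - LinearMap.mulRight k h)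
  refine (h1.comp (f := fun d : ℤ => (d : k)) Int.cast_injective).mono fun d x hx => ?_
  rw [Function.comp_apply, Module.End.mem_eigenspace_iff]
  exact hh d x hx

/-! ### Density and completeness in the completion -/

namespace DegreewiseCompletion

variable {k A : Type*} [Field k] [Ring A] [Algebra k A] (𝒜 : ℤ → Submodule k A)

theorem iSupIndep_cauchySeq [CharZero k] {𝒜 : ℤ → Submodule k A} {h : A}
    (hh : IsHamiltonian 𝒜 h) :
    iSupIndep (cauchySeq 𝒜) :=
  IsHamiltonian.iSupIndep (h := fun _ => h) fun d _ hx => funext fun i => hh d _ (hx.1 i)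

theorem const_mem_cauchySeq {d : ℤ} {x : A} (hx : x ∈ 𝒜 d) :
    (fun _ => x : ℕ → A) ∈ cauchySeq 𝒜 d :=
  ⟨fun _ => hx, fun _ => ⟨0, fun _ _ _ _ => by simp⟩⟩

variable [SetLike.GradedMonoid 𝒜]

theorem mk_mem_gr {d : ℤ} {x : cauchyAlg 𝒜} (hx : (x : ℕ → A) ∈ cauchySeq 𝒜 d) :
    mk 𝒜 x ∈ (topology 𝒜).gr d := ⟨x, hx, rfl⟩

theorem mk_mem_nbhd {d : ℤ} {n : ℕ} {x : cauchyAlg 𝒜} (hx : (x : ℕ → A) ∈ cauchySeq 𝒜 d)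
    (hx' : (x : ℕ → A) ∈ smallSeq 𝒜 d n) : mk 𝒜 x ∈ (topology 𝒜).nbhd d n :=
  ⟨x, ⟨hx, hx'⟩, rfl⟩

theorem mk_eq_zero_iff {x : cauchyAlg 𝒜} :
    mk 𝒜 x = 0 ↔ (x : ℕ → A) ∈ ⨆ d, nullSeq 𝒜 d :=
  Ideal.Quotient.eq_zero_iff_mem

theorem const_mem_cauchyAlg (htop : ⨆ d, 𝒜 d = ⊤) (x : A) :
    Pi.constAlgHom k ℕ A x ∈ cauchyAlg 𝒜 := by
  have hx : x ∈ ⨆ d, 𝒜 d := htop ▸ Submodule.mem_top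
  induction hx using Submodule.iSup_induction' with
  | mem d x hx => exact Submodule.mem_iSup_of_mem d (const_mem_cauchySeq 𝒜 hx)
  | zero => rw [map_zero]; exact zero_mem _
  | add x y _ _ hx hy => rw [map_add]; exact add_mem hx hy

/-- The canonical homomorphism `A → Â`. -/
def of (htop : ⨆ d, 𝒜 d = ⊤) : A →ₐ[k] DegreewiseCompletion 𝒜 :=
  (mk 𝒜).comp ((Pi.constAlgHom k ℕ A).codRestrict (cauchyAlg 𝒜) (const_mem_cauchyAlg 𝒜 htop))

variable {𝒜} (htop : ⨆ d, 𝒜 d = ⊤)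

theorem of_mem_gr {d : ℤ} {x : A} (hx : x ∈ 𝒜 d) : of 𝒜 htop x ∈ (topology 𝒜).gr d :=
  mk_mem_gr 𝒜 (const_mem_cauchySeq 𝒜 hx)

theorem of_mem_nbhd {d : ℤ} {n : ℕ} {x : A} (hx : x ∈ lowProducts 𝒜 d n) :
    of 𝒜 htop x ∈ (topology 𝒜).nbhd d n :=
  mk_mem_nbhd 𝒜 (const_mem_cauchySeq 𝒜 (lowProducts_le 𝒜 d n hx))
    ⟨fun _ => lowProducts_le 𝒜 d n hx, 0, fun _ _ => hx⟩

/-- A Cauchy sequence converges to its class. -/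
theorem lim_sub_of_mem_nbhd {d : ℤ} {x : ℕ → A} (hx : x ∈ cauchySeq 𝒜 d) (n : ℕ) :
    ∃ N, ∀ i ≥ N, lim 𝒜 x hx - of 𝒜 htop (x i) ∈ (topology 𝒜).nbhd d n := by
  obtain ⟨N, hN⟩ := hx.2 n
  refine ⟨N, fun i hi => ?_⟩
  rw [lim, of, AlgHom.comp_apply, ← map_sub]
  exact mk_mem_nbhd 𝒜 (sub_mem hx (const_mem_cauchySeq 𝒜 (hx.1 i)))
    ⟨fun j => sub_mem (hx.1 j) (hx.1 i), N, fun j hj => hN j hj i hi⟩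

theorem exists_of_sub_mem_nbhd {d : ℤ} {n m : ℕ} {y : DegreewiseCompletion 𝒜}
    (hy : y ∈ (topology 𝒜).nbhd d n) :
    ∃ c ∈ lowProducts 𝒜 d n, y - of 𝒜 htop c ∈ (topology 𝒜).nbhd d m := by
  obtain ⟨⟨x, hx'⟩, ⟨hx, -, M, hM⟩, rfl⟩ := hy
  obtain ⟨N, hN⟩ := lim_sub_of_mem_nbhd htop hx m
  exact ⟨x (max M N), hM _ (le_max_left _ _), hN _ (le_max_right _ _)⟩

theorem exists_of_sub_mem_nbhd_of_mem_gr {d : ℤ} (m : ℕ) {y : DegreewiseCompletion 𝒜}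
    (hy : y ∈ (topology 𝒜).gr d) :
    ∃ c ∈ 𝒜 d, y - of 𝒜 htop c ∈ (topology 𝒜).nbhd d m := by
  obtain ⟨⟨x, hx'⟩, hx, rfl⟩ := hy
  obtain ⟨N, hN⟩ := lim_sub_of_mem_nbhd htop hx m
  exact ⟨x N, hx.1 N, hN _ le_rfl⟩

theorem isHamiltonian_of {h : A} (hh : IsHamiltonian 𝒜 h) :
    IsHamiltonian (topology 𝒜).gr (of 𝒜 htop h) := by
  rintro d _ ⟨x, hx, rfl⟩
  rw [of, AlgHom.comp_apply]
  simp only [AlgHom.toLinearMap_apply]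
  rw [← map_mul, ← map_mul, ← map_sub, ← map_smul]
  congr 1
  ext i
  exact hh d _ (hx.1 i)

/-- A priori the constant sequence `c` differs from a small Cauchy sequence by a sum of null
sequences of various degrees. Independence of the degrees makes the difference a null sequence of
degree `d`, hence eventually small. -/
theorem mem_lowProducts_of_of_mem_nbhd [CharZero k] {h : A} (hh : IsHamiltonian 𝒜 h) {d : ℤ}
    {n : ℕ} {c : A} (hc : c ∈ 𝒜 d) (hcn : of 𝒜 htop c ∈ (topology 𝒜).nbhd d n) :
    c ∈ lowProducts 𝒜 d n := by
  obtain ⟨w, ⟨hw, hw'⟩, hwc⟩ := hcn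
  rw [of, AlgHom.comp_apply, AlgHom.toLinearMap_apply, ← sub_eq_zero, ← map_sub,
    mk_eq_zero_iff] at hwc
  have h1 := (iSupIndep_cauchySeq hh).mem_of_mem_iSup (nullSeq_le_cauchySeq 𝒜) hwc
    (sub_mem hw (const_mem_cauchySeq 𝒜 hc))
  rw [nullSeq, Submodule.mem_iInf] at h1
  obtain ⟨N, hN⟩ := (sub_mem hw' (h1 n)).2
  simpa using hN N le_rfl

theorem topology_exists_lim (htop : ⨆ d, 𝒜 d = ⊤) [CharZero k] {h : A}
    (hh : IsHamiltonian 𝒜 h) (d : ℤ)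
    (y : ℕ → DegreewiseCompletion 𝒜) (hy : ∀ n, y n ∈ (topology 𝒜).gr d)
    (hy' : ∀ n, y (n + 1) - y n ∈ (topology 𝒜).nbhd d n) :
    ∃ a ∈ (topology 𝒜).gr d, ∀ n, a - y n ∈ (topology 𝒜).nbhd d n := by
  -- Diagonal argument: `y n` is approximated from `A(d)` to precision `n`, and the approximations
  -- form a Cauchy sequence whose class is the limit.
  choose c hc hcy using fun n => exists_of_sub_mem_nbhd_of_mem_gr htop n (hy n)
  have hstep : ∀ n, c (n + 1) - c n ∈ lowProducts 𝒜 d n := by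
    intro n
    refine mem_lowProducts_of_of_mem_nbhd htop hh (sub_mem (hc _) (hc _)) ?_
    have h1 := sub_mem (add_mem (hy' n) (hcy n))
      ((topology 𝒜).nbhd_anti d (Nat.le_succ n) (hcy (n + 1)))
    rw [map_sub]
    convert h1 using 1
    abel
  have hle : ∀ n, ∀ m ≥ n, c m - c n ∈ lowProducts 𝒜 d n := by
    intro n m hm
    induction m, hm using Nat.le_induction with
    | base => simp
    | succ m hm ih =>
      have := add_mem (lowProducts_anti 𝒜 d hm (hstep m)) ih
      rwa [sub_add_sub_cancel] at this
  have hcau : c ∈ cauchySeq 𝒜 d := by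
    refine ⟨hc, fun n => ⟨n, fun i hi j hj => ?_⟩⟩
    have := sub_mem (hle n i hi) (hle n j hj)
    rwa [sub_sub_sub_cancel_right] at this
  refine ⟨lim 𝒜 c hcau, mk_mem_gr 𝒜 hcau, fun n => ?_⟩
  obtain ⟨N, hN⟩ := lim_sub_of_mem_nbhd htop hcau n
  have h1 := sub_mem (add_mem (hN (max N n) (le_max_left _ _))
    (of_mem_nbhd htop (hle n (max N n) (le_max_right _ _)))) (hcy n)
  rw [map_sub] at h1
  convert h1 using 1
  abel

/-! ### The quotient by a closed ideal -/

variable (S : Set (DegreewiseCompletion 𝒜))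

theorem toClosedQuotient_eq_zero_iff {x : DegreewiseCompletion 𝒜} :
    toClosedQuotient 𝒜 S x = 0 ↔ x ∈ closedSpan 𝒜 S :=
  Ideal.Quotient.eq_zero_iff_mem

theorem toClosedQuotient_mem_gr {d : ℤ} {x : DegreewiseCompletion 𝒜}
    (hx : x ∈ (topology 𝒜).gr d) : toClosedQuotient 𝒜 S x ∈ (quotientTopology 𝒜 S).gr d :=
  ⟨x, hx, rfl⟩

theorem toClosedQuotient_mem_nbhd {d : ℤ} {n : ℕ} {x : DegreewiseCompletion 𝒜}
    (hx : x ∈ (topology 𝒜).nbhd d n) :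
    toClosedQuotient 𝒜 S x ∈ (quotientTopology 𝒜 S).nbhd d n :=
  ⟨x, hx, rfl⟩

theorem quotient_gr_mul_gr_mem {d e : ℤ} {a b : ClosedQuotient 𝒜 S}
    (ha : a ∈ (quotientTopology 𝒜 S).gr d) (hb : b ∈ (quotientTopology 𝒜 S).gr e) :
    a * b ∈ (quotientTopology 𝒜 S).gr (d + e) := by
  obtain ⟨x, hx, rfl⟩ := ha
  obtain ⟨y, hy, rfl⟩ := hb
  exact ⟨x * y, gr_mul_gr_mem 𝒜 hx hy, map_mul (toClosedQuotient 𝒜 S) x y⟩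

theorem quotient_gr_mul_nbhd_mem {d e : ℤ} {n : ℕ} {a b : ClosedQuotient 𝒜 S}
    (ha : a ∈ (quotientTopology 𝒜 S).gr d) (hb : b ∈ (quotientTopology 𝒜 S).nbhd e n) :
    a * b ∈ (quotientTopology 𝒜 S).nbhd (d + e) n := by
  obtain ⟨x, hx, rfl⟩ := ha
  obtain ⟨y, hy, rfl⟩ := hb
  exact ⟨x * y, gr_mul_nbhd_mem 𝒜 hx hy, map_mul (toClosedQuotient 𝒜 S) x y⟩

theorem quotient_nbhd_mul_gr_mem {d e : ℤ} {m n : ℕ} (h : (n : ℤ) + e ≤ m)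
    {a b : ClosedQuotient 𝒜 S} (ha : a ∈ (quotientTopology 𝒜 S).nbhd d m)
    (hb : b ∈ (quotientTopology 𝒜 S).gr e) : a * b ∈ (quotientTopology 𝒜 S).nbhd (d + e) n := by
  obtain ⟨x, hx, rfl⟩ := ha
  obtain ⟨y, hy, rfl⟩ := hb
  exact ⟨x * y, nbhd_mul_gr_mem 𝒜 h hx hy, map_mul (toClosedQuotient 𝒜 S) x y⟩

/-- The canonical homomorphism from `A` to the quotient of `Â`. -/
def toQuotient : A →ₐ[k] ClosedQuotient 𝒜 S := (toClosedQuotient 𝒜 S).comp (of 𝒜 htop)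

theorem toQuotient_mem_gr {d : ℤ} {x : A} (hx : x ∈ 𝒜 d) :
    toQuotient htop S x ∈ (quotientTopology 𝒜 S).gr d :=
  toClosedQuotient_mem_gr S (of_mem_gr htop hx)

theorem toQuotient_mem_nbhd {d : ℤ} {n : ℕ} {x : A} (hx : x ∈ lowProducts 𝒜 d n) :
    toQuotient htop S x ∈ (quotientTopology 𝒜 S).nbhd d n :=
  toClosedQuotient_mem_nbhd S (of_mem_nbhd htop hx)

theorem toQuotient_mem_lowProducts {d : ℤ} {n : ℕ} {x : A} (hx : x ∈ lowProducts 𝒜 d n) :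
    toQuotient htop S x ∈ lowProducts (quotientTopology 𝒜 S).gr d n := by
  have hgr (d : ℤ) : (𝒜 d).map (toQuotient htop S).toLinearMap ≤ (quotientTopology 𝒜 S).gr d :=
    Submodule.map_le_iff_le_comap.2 fun x hx => toQuotient_mem_gr htop S hx
  have h : (lowProducts 𝒜 d n).map (toQuotient htop S).toLinearMap ≤
      lowProducts (quotientTopology 𝒜 S).gr d n := by
    simp only [lowProducts, Submodule.map_iSup, Submodule.map_mul]
    exact iSup_mono fun j => iSup_mono fun _ => mul_le_mul' (hgr _) (hgr _)
  exact h ⟨x, hx, rfl⟩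

theorem quotient_lowProducts_le_nbhd (d : ℤ) (n : ℕ) :
    lowProducts (quotientTopology 𝒜 S).gr d n ≤ (quotientTopology 𝒜 S).nbhd d n := by
  refine iSup_le fun j => iSup_le fun hj => Submodule.mul_le.2 ?_
  rintro _ ⟨_, ⟨x, hx, rfl⟩, rfl⟩ _ ⟨_, ⟨y, hy, rfl⟩, rfl⟩
  simp only [AlgHom.toLinearMap_apply]
  rw [← map_mul, ← map_mul]
  have hxy := cauchySeq_mul_mem 𝒜 hx hy
  rw [sub_add_cancel] at hxy
  refine toClosedQuotient_mem_nbhd S (mk_mem_nbhd 𝒜 hxy ⟨hxy.1, 0, fun i _ => ?_⟩)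
  exact le_iSup_of_le (f := fun j : ℤ => ⨆ _ : j ≤ -(n : ℤ) - 1, 𝒜 (d - j) * 𝒜 j) j
    (le_iSup_of_le hj le_rfl) (Submodule.mul_mem_mul (hx.1 i) (hy.1 i))

/-- Low products are termwise low products of Cauchy sequences, hence lie in the neighbourhood.
Conversely, a small element is approximated to any precision by images of elements of `lowProducts`
in `A`. -/
theorem quotient_canonicalIdeal (htop : ⨆ d, 𝒜 d = ⊤) (d : ℤ) (n : ℕ) :
    (quotientTopology 𝒜 S).canonicalIdeal d n = (quotientTopology 𝒜 S).nbhd d n := by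
  refine le_antisymm ((iInf_le _ n).trans (sup_le
    (inf_le_left.trans (quotient_lowProducts_le_nbhd S d n)) le_rfl)) (le_iInf fun m => ?_)
  rintro _ ⟨y, hy, rfl⟩
  obtain ⟨c, hc, hyc⟩ := exists_of_sub_mem_nbhd htop (m := m) hy
  have h1 := Submodule.add_mem_sup (show toQuotient htop S c ∈
      lowProducts (quotientTopology 𝒜 S).gr d n ⊓ (quotientTopology 𝒜 S).gr d from
    ⟨toQuotient_mem_lowProducts htop S hc, toQuotient_mem_gr htop S (lowProducts_le 𝒜 d n hc)⟩)
    (toClosedQuotient_mem_nbhd S hyc)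
  rw [map_sub] at h1
  simpa [toQuotient] using h1

theorem isHamiltonian_toQuotient {h : A} (hh : IsHamiltonian 𝒜 h) :
    IsHamiltonian (quotientTopology 𝒜 S).gr (toQuotient htop S h) := by
  rintro d _ ⟨x, hx, rfl⟩
  simp only [AlgHom.toLinearMap_apply, toQuotient, AlgHom.comp_apply]
  rw [← map_mul, ← map_mul, ← map_sub, ← map_smul, isHamiltonian_of htop hh d x hx]

theorem quotientTopology_isCompatible (htop : ⨆ d, 𝒜 d = ⊤) [CharZero k] {h : A}
    (hh : IsHamiltonian 𝒜 h) :
    (quotientTopology 𝒜 S).IsCompatible where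
  gradedMonoid :=
    { one_mem := by
        rw [← map_one (toQuotient htop S)]
        exact toQuotient_mem_gr htop S SetLike.GradedOne.one_mem
      mul_mem := fun _ _ _ _ => quotient_gr_mul_gr_mem S }
  isInternal := by
    refine DirectSum.isInternal_submodule_of_iSupIndep_of_iSup_eq_top
      (isHamiltonian_toQuotient htop S hh).iSupIndep ?_
    have h1 : ⨆ d, ((topology 𝒜).gr d).map (toClosedQuotient 𝒜 S).toLinearMap = ⊤ := by
      rw [← Submodule.map_iSup, iSup_gr, Submodule.map_top, LinearMap.range_eq_top]
      exact Ideal.Quotient.mkₐ_surjective k (closedIdeal 𝒜 S)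
    exact h1
  continuous_mul := by
    intro d e a ha b hb n
    -- Left multiplication preserves the index of a neighbourhood, whereas right multiplication by
    -- degree `e` can cost `e`.
    refine ⟨n + e.toNat, fun x hx y hy => ?_⟩
    have hx' := (quotientTopology 𝒜 S).nbhd_le _ _ hx
    have hy' := (quotientTopology 𝒜 S).nbhd_anti e (Nat.le_add_right n e.toNat) hy
    have h1 : (a + x) * (b + y) - a * b = a * y + x * b + x * y := by noncomm_ring
    rw [h1]
    refine add_mem (add_mem (quotient_gr_mul_nbhd_mem S ha hy') ?_)
      (quotient_gr_mul_nbhd_mem S hx' hy')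
    exact quotient_nbhd_mul_gr_mem S (by push_cast; omega) hx hb
  isOpen := fun d n => ⟨n, (quotient_canonicalIdeal S htop d n).ge⟩
  basis := fun d m => ⟨m, (quotient_canonicalIdeal S htop d m).le⟩

theorem quotientTopology_isComplete (htop : ⨆ d, 𝒜 d = ⊤) [CharZero k] {h : A}
    (hh : IsHamiltonian 𝒜 h) :
    (quotientTopology 𝒜 S).IsComplete where
  separated := by
    refine fun d => (Submodule.eq_bot_iff _).2 fun x hx => ?_
    rw [Submodule.mem_iInf] at hx
    choose y hy hyx using hx
    have hcl : ∀ e, (topology 𝒜).closure e (idealSpan 𝒜 S) ≤ (topology 𝒜).gr e := fun e =>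
      (iInf_le _ 0).trans (sup_le inf_le_right ((topology 𝒜).nbhd_le e 0))
    have hgr : ∀ n, y n ∈ (topology 𝒜).gr d := fun n => (topology 𝒜).nbhd_le d n (hy n)
    rw [← hyx 0]
    refine (toClosedQuotient_eq_zero_iff S).2 (Submodule.mem_iSup_of_mem d ?_)
    rw [DegreewiseTopology.closure, Submodule.mem_iInf]
    intro n
    -- All the `y n` lift the same `x`. By independence of the degrees their differences lie in the
    -- degree `d` closure, so `y 0` is in that closure up to the arbitrarily small `y n`.
    have h1 : y 0 - y n ∈ closedSpan 𝒜 S := by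
      rw [← toClosedQuotient_eq_zero_iff, map_sub, sub_eq_zero]
      exact (hyx 0).trans (hyx n).symm
    have h2 := (isHamiltonian_of htop hh).iSupIndep.mem_of_mem_iSup hcl h1
      (sub_mem (hgr 0) (hgr n))
    rw [DegreewiseTopology.closure, Submodule.mem_iInf] at h2
    have h3 := add_mem (h2 n) (Submodule.mem_sup_right (hy n))
    rwa [sub_add_cancel] at h3
  exists_lim := by
    intro d x hx hx'
    obtain ⟨y₀, hy₀, hyx₀⟩ := hx 0
    choose w hw hwx using hx'
    -- Lifting the increments, rather than the terms, yields a lift of `x` that is again Cauchy.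
    let y : ℕ → DegreewiseCompletion 𝒜 := fun n => y₀ + ∑ i ∈ Finset.range n, w i
    have hy : ∀ n, y n ∈ (topology 𝒜).gr d := fun n =>
      add_mem hy₀ (sum_mem fun i _ => (topology 𝒜).nbhd_le d i (hw i))
    have hyx : ∀ n, toClosedQuotient 𝒜 S (y n) = x n := by
      intro n
      induction n with
      | zero => simpa [y] using hyx₀
      | succ n ih =>
        have h1 : y (n + 1) = y n + w n := by simp [y, Finset.sum_range_succ, add_assoc]
        have h2 : toClosedQuotient 𝒜 S (w n) = x (n + 1) - x n := hwx n
        rw [h1, map_add, ih, h2, add_sub_cancel]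
    obtain ⟨a, ha, hay⟩ := topology_exists_lim htop hh d y hy
      (fun n => by simpa [y, Finset.sum_range_succ] using hw n)
    refine ⟨toClosedQuotient 𝒜 S a, toClosedQuotient_mem_gr S ha, fun n => ?_⟩
    rw [← hyx, ← map_sub]
    exact toClosedQuotient_mem_nbhd S (hay n)

theorem quotient_gr_le (d : ℤ) (n : ℕ) :
    (quotientTopology 𝒜 S).gr d ≤
      (𝒜 d).map (toQuotient htop S).toLinearMap ⊔ (quotientTopology 𝒜 S).nbhd d n := by
  rintro _ ⟨y, hy, rfl⟩
  obtain ⟨c, hc, hyc⟩ := exists_of_sub_mem_nbhd_of_mem_gr htop n hy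
  have h1 := Submodule.add_mem_sup (Submodule.mem_map_of_mem
    (f := (toQuotient htop S).toLinearMap) hc) (toClosedQuotient_mem_nbhd S hyc)
  rw [map_sub] at h1
  simpa [toQuotient] using h1

/-- The limit of the sequence dies in the quotient, so the images of its late terms are small.
Applied to the Borcherds series, this replaces infinite relations by finite partial sums. -/
theorem exists_toQuotient_mem_nbhd {d : ℤ} {x : ℕ → A} (hx : x ∈ cauchySeq 𝒜 d)
    (hS : lim 𝒜 x hx ∈ S) (n : ℕ) :
    ∃ N, ∀ i ≥ N, toQuotient htop S (x i) ∈ (quotientTopology 𝒜 S).nbhd d n := by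
  obtain ⟨N, hN⟩ := lim_sub_of_mem_nbhd htop hx n
  have h0 : toClosedQuotient 𝒜 S (lim 𝒜 x hx) = 0 := by
    refine (toClosedQuotient_eq_zero_iff S).2 (Submodule.mem_iSup_of_mem d ?_)
    rw [DegreewiseTopology.closure, Submodule.mem_iInf]
    exact fun m => Submodule.mem_sup_left
      ⟨(mem_idealSpan 𝒜 S).2 (TwoSidedIdeal.subset_span hS), mk_mem_gr 𝒜 hx⟩
  refine ⟨N, fun i hi => ?_⟩
  have h1 := toClosedQuotient_mem_nbhd S (hN i hi)
  rw [map_sub, h0, zero_sub, neg_mem_iff] at h1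
  exact h1

end DegreewiseCompletion

/-! ### Finite-dimensionality for the current algebra -/

namespace VertexOperatorAlgebra

open DegreewiseCompletion

variable {k V : Type*} [Field k] [AddCommGroup V] [Module k V] (𝒱 : VertexOperatorAlgebra k V)

theorem isBorcherdsStable_comap (l : ℕ) :
    𝒱.IsBorcherdsStable l fun d => (𝒱.currentTopology.nbhd d l).comap
      (toQuotient 𝒱.iSup_envelopingGr 𝒱.borcherdsSet).toLinearMap where
  low := fun d _ hx => toQuotient_mem_nbhd 𝒱.iSup_envelopingGr 𝒱.borcherdsSet hx
  mul_mem := by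
    intro d e x hx y hy
    rw [Submodule.mem_comap, AlgHom.toLinearMap_apply, map_mul]
    exact quotient_gr_mul_nbhd_mem 𝒱.borcherdsSet
      (toQuotient_mem_gr 𝒱.iSup_envelopingGr 𝒱.borcherdsSet hx) hy
  borcherds := fun r s a b n u v hu hv =>
    exists_toQuotient_mem_nbhd 𝒱.iSup_envelopingGr 𝒱.borcherdsSet
      (𝒱.borcherdsPartialSum_mem a b n hu hv) ⟨r, s, a, b, n, u, v, hu, hv, rfl⟩ l

theorem finiteDimensional_canonicalQuotient [CharZero k] (hV : 𝒱.IsC2Finite) (d : ℤ) (n : ℕ) :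
    FiniteDimensional k (𝒱.currentTopology.canonicalQuotient d n) := by
  obtain ⟨P, hP, hle⟩ := (𝒱.isBorcherdsStable_comap n).exists_fg_envelopingGr_le hV d
  let ρ := (toQuotient 𝒱.iSup_envelopingGr 𝒱.borcherdsSet).toLinearMap
  have h1 : 𝒱.currentTopology.gr d ≤ P.map ρ ⊔ 𝒱.currentTopology.canonicalIdeal d n := by
    rw [currentTopology, quotient_canonicalIdeal _ 𝒱.iSup_envelopingGr]
    refine (quotient_gr_le 𝒱.iSup_envelopingGr 𝒱.borcherdsSet d n).trans (sup_le ?_ le_sup_right)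
    refine (Submodule.map_mono hle).trans ?_
    rw [Submodule.map_sup]
    exact sup_le_sup_left (Submodule.map_comap_le _ _) _
  let I := 𝒱.currentTopology.canonicalIdeal d n
  have hfin : FiniteDimensional k ((P.map ρ).map I.mkQ) :=
    Module.Finite.iff_fg.2 ((hP.map ρ).map I.mkQ)
  -- `Q_n(d)` embeds in the quotient of the whole algebra by the subspace `I`, where its image lies
  -- in the image of the finite-dimensional `P`.
  let f : 𝒱.currentTopology.canonicalQuotient d n →ₗ[k] 𝒱.CurrentAlgebra ⧸ I :=
    Submodule.mapQ _ I (𝒱.currentTopology.gr d).subtype le_rfl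
  have hf : Function.Injective f := by
    rw [← LinearMap.ker_eq_bot]
    refine (Submodule.ker_mapQ _ _ _ _).trans ?_
    exact Submodule.mkQ_map_self _
  have hrange : ∀ x, f x ∈ (P.map ρ).map I.mkQ := by
    intro x
    obtain ⟨⟨y, hy⟩, rfl⟩ := Submodule.mkQ_surjective _ x
    obtain ⟨p, hp, i, hi, rfl⟩ := Submodule.mem_sup.1 (h1 hy)
    refine ⟨p, hp, ?_⟩
    change I.mkQ p = I.mkQ (p + i)
    rw [map_add, left_eq_add]
    exact (Submodule.Quotient.mk_eq_zero _).2 hi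
  exact FiniteDimensional.of_injective (f.codRestrict _ hrange)
    fun x y hxy => hf (congrArg Subtype.val hxy)

end VertexOperatorAlgebra

end

theorem mainTheorem1 {k V : Type*} [Field k] [IsAlgClosed k] [CharZero k] [AddCommGroup V]
    [Module k V] (𝒱 : VertexOperatorAlgebra k V) (hV : 𝒱.IsC2Finite) :
    𝒱.currentTopology.IsQuasiFinite where
  compatible := DegreewiseCompletion.quotientTopology_isCompatible _ 𝒱.iSup_envelopingGr
    fun _ _ => 𝒱.omega_mul_sub
  complete := DegreewiseCompletion.quotientTopology_isComplete _ 𝒱.iSup_envelopingGr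
    fun _ _ => 𝒱.omega_mul_sub
  finite := 𝒱.finiteDimensional_canonicalQuotient hV
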